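/- Let $X\subseteq\mathbb R^n$ be closed, let $\rho$ be a probability measure on $X\times\mathbb R$ with marginal $\rho_X$ on $X$, with $\operatorname{supp}\rho\subseteq X\times[-M_\rho,M_\rho]$ for a constant $M_\rho\ge 0$, and let $f_\rho(x)=\int y\,d\rho(y\,|\,x)$ be its regression function. Let $K:X\times X\to\mathbb R$ be a Mercer kernel (continuous, symmetric, positive semi-definite) with $\kappa:=\sup_{x\in X}\sqrt{K(x,x)}<\infty$, let $\mathcal H_K$ be its reproducing kernel Hilbert space with norm $\|\cdot\|_K$, let $K_x=K(x,\cdot)\in\mathcal H_K$, and let $(L_Kf)(x)=\int_X K(x,s)f(s)\,d\rho_X(s)$ on $L^2_{\rho_X}$, with norm $\|\cdot\|_\rho$ there. Assume that all eigenvalues $\mu_\alpha$ of $L_K:L^2_{\rho_X}\to L^2_{\rho_X}$ are positive; with an orthonormal eigensystem $(\mu_\alpha,\phi_\alpha)$, $L_K^r\big(\sum_\alpha a_\alpha\phi_\alpha\big)=\sum_\alpha a_\alpha\mu_\alpha^r\phi_\alpha$ for $r>0$, and $L_K^{-r}f\in L^2_{\rho_X}$ means that $f$ is in the image of $L_K^r$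 on $L^2_{\rho_X}$, with preimage $L_K^{-r}f$. **Theorem B (upper bounds for $\mathcal H_K$-convergence).** Assume $L_K^{-r}f_\rho\in L^2_{\rho_X}$ for some $r\in(1/2,3/2]$. Let $a\ge1$ and $t_0>0$ with $t_0^{\theta}\ge a\kappa^2+1$, where $\theta=2r/(2r+1)$. Put $\bar t=t+t_0$, $$\gamma_t=a\,\bar t^{\,-2r/(2r+1)},\qquad \lambda_t=\frac1a\,\bar t^{\,-1/(2r+1)},$$ let $(x_t,y_t)_{t\ge1}$ be i.i.d. with law $\rho$, and let $f_0=0$ and, for $t\ge1$, $$f_t=f_{t-1}-\gamma_t\big[(f_{t-1}(x_t)-y_t)K_{x_t}+\lambda_tf_{t-1}\big]\in\mathcal H_K .$$ Then $f_\rho\in\mathcal H_K$, and for every integer $t\ge1$ and every $\delta\in(0,1)$, with probability at least $1-\delta$, $$\|f_t-f_\rho\|_K\le\frac{C_0}{\bar t}+\Big(C_1a^{1/2-r}+C_2\,a\log\frac2\delta\Big)\Big(\frac1{\bar t}\Big)^{\frac{2r-1}{4r+2}},$$ where $$C_0=2\sqrt a\,t_0^{\frac{4r+3}{4r+2}}M_\rho,\qquad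 C_1=\frac{20r-2}{(2r-1)(2r+3)}\|L_K^{-r}f_\rho\|_\rho,\qquad C_2=\frac{20(\kappa+1)^2M_\rho}{\kappa}.$$ Moreover $f_t\to f_\rho$ in $\mathcal H_K$ almost surely. (Here "$f_\rho\in\mathcal H_K$" means that $f_\rho$ coincides $\rho_X$-almost everywhere with an element of $\mathcal H_K$, and in $\|f_t-f_\rho\|_K$ and the limit, $f_\rho$ stands for this element; if it is not unique, which can only happen when $\rho_X$ does not have full support, the one of least $\mathcal H_K$-norm, which exists and is unique, is taken.) -/

import Mathlib

open MeasureTheory ProbabilityTheory Filter Topology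

noncomputable section

/-- A Mercer kernel on a topological space: a continuous, symmetric, positive semi-definite
real function of two variables. -/
structure MercerKernel (X : Type*) [TopologicalSpace X] where
  /-- the underlying function `(x, x') ↦ K(x, x')` -/
  toFun : X → X → ℝ
  continuous_toFun : Continuous (Function.uncurry toFun)
  symm : ∀ x x' : X, toFun x x' = toFun x' x
  posSemidef : ∀ (m : ℕ) (x : Fin m → X) (c : Fin m → ℝ),
    0 ≤ ∑ i, ∑ j, c i * c j * toFun (x i) (x j)

namespace MercerKernel

variable {X : Type*} [TopologicalSpace X]

instance : CoeFun (MercerKernel X) (fun _ => X → X → ℝ) := ⟨MercerKernel.toFun⟩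

/-- The kernel in Mathlib's format: `K(x, x')` as multiplication by a scalar on `ℝ`. -/
def toMatrix (K : MercerKernel X) : Matrix X X (ℝ →L[ℝ] ℝ) :=
  Matrix.of fun x x' => K x x' • ContinuousLinearMap.id ℝ ℝ

lemma toMatrix_apply (K : MercerKernel X) (x x' : X) (v : ℝ) :
    K.toMatrix x x' v = K x x' * v := by
  simp [toMatrix]

instance factPosSemidef (K : MercerKernel X) : Fact K.toMatrix.PosSemidef := by
  have tfae := (RKHS.posSemidef_tfae (𝕜 := ℝ) (V := ℝ) (K := K.toMatrix)).out 0 2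
  refine ⟨tfae.mpr ⟨?_, ?_⟩⟩
  · ext x x'
    have hid : star (ContinuousLinearMap.id ℝ ℝ) = ContinuousLinearMap.id ℝ ℝ :=
      star_one (ℝ →L[ℝ] ℝ)
    simp [toMatrix, K.symm x x', hid]
  · intro vv
    have e := vv.support.equivFin
    have h := K.posSemidef vv.support.card (fun i => (e.symm i : X))
      (fun i => vv (e.symm i : X))
    have h2 : (∑ i, ∑ j, vv (e.symm i : X) * vv (e.symm j : X) *
        K (e.symm i : X) (e.symm j : X)) =
        ∑ x ∈ vv.support, ∑ x' ∈ vv.support, vv x * vv x' * K x x' := by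
      rw [← Finset.sum_coe_sort vv.support, ← e.symm.sum_comp]
      refine Finset.sum_congr rfl fun i _ => ?_
      rw [← Finset.sum_coe_sort vv.support, ← e.symm.sum_comp]
    rw [h2] at h
    simp only [Finsupp.sum, toMatrix_apply, RCLike.re_to_real]
    refine h.trans_eq (Finset.sum_congr rfl fun x _ => Finset.sum_congr rfl fun x' _ => ?_)
    rw [K.symm x x']
    simp [mul_comm, mul_left_comm]

/-- The reproducing kernel Hilbert space `H_K` of `K`: the completion of the span of the
functions `K_x` for the inner product with `⟨K_x, K_x'⟩ = K(x, x')`. Its elements are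
functions on `X`. -/
abbrev HK (K : MercerKernel X) : Type _ := RKHS.OfKernel K.toMatrix

/-- The function `K_x = K(x, ·)` as an element of `H_K`. -/
def kerAt (K : MercerKernel X) (x : X) : K.HK := RKHS.kerFun K.HK x 1

lemma kerAt_apply (K : MercerKernel X) (x x' : X) : (K.kerAt x) x' = K x x' := by
  rw [kerAt, RKHS.kerFun_apply, RKHS.OfKernel.kernel_ofKernel, toMatrix_apply, K.symm x x',
    mul_one]

/-- `κ = sup_x √K(x, x)`. -/
def kappa (K : MercerKernel X) : ℝ := ⨆ x : X, √(K x x)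

/-- The online learning sequence: `f_0 = 0` and
`f_{t+1} = f_t - γ_{t+1} [(f_t(x) - y) K_x + λ_{t+1} f_t]`, where `(x, y) = z t` is the
`(t+1)`-st example (examples are numbered from `0` here). -/
def onlineSeq (K : MercerKernel X) (γ lam : ℕ → ℝ) (z : ℕ → X × ℝ) : ℕ → K.HK
  | 0 => 0
  | t + 1 =>
    onlineSeq K γ lam z t - γ (t + 1) •
      (((onlineSeq K γ lam z t) (z t).1 - (z t).2) • K.kerAt (z t).1
        + lam (t + 1) • onlineSeq K γ lam z t)

variable [MeasurableSpace X]

/-- The integral operator `(L_K f)(x) = ∫ K(x, s) f(s) dν(s)`. -/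
def integralOp (K : MercerKernel X) (ν : Measure X) (f : X → ℝ) : X → ℝ :=
  fun x => ∫ s, K x s * f s ∂ν

/-- `φ ∈ L²(ν)` and `L_K φ = μ φ` in `L²(ν)` (with `φ = 0` allowed). -/
def IsEigenpair (K : MercerKernel X) (ν : Measure X) (μ : ℝ) (φ : X → ℝ) : Prop :=
  MemLp φ 2 ν ∧ ∀ᵐ x ∂ν, K.integralOp ν φ x = μ * φ x

/-- All eigenvalues of `L_K : L²(ν) → L²(ν)` are positive. -/
def EigenvaluesPos (K : MercerKernel X) (ν : Measure X) : Prop :=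
  ∀ (μ : ℝ) (φ : X → ℝ), K.IsEigenpair ν μ φ → (¬ ∀ᵐ x ∂ν, φ x = 0) → 0 < μ

/-- `f = L_K^r g` in `L²(ν)`: the coefficient of `f` along every eigenfunction of `L_K` is the
coefficient of `g` times the `r`-th power of the eigenvalue, that is,
`L_K^r (∑ a_α φ_α) = ∑ a_α μ_α^r φ_α` for an orthonormal eigensystem `(μ_α, φ_α)`.
So `g = L_K^{-r} f` when all eigenvalues are positive. -/
structure IsRpow (K : MercerKernel X) (ν : Measure X) (r : ℝ) (g f : X → ℝ) : Prop where
  memLp_left : MemLp g 2 ν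
  memLp_right : MemLp f 2 ν
  coeff_eq : ∀ (μ : ℝ) (φ : X → ℝ), K.IsEigenpair ν μ φ →
    ∫ x, φ x * f x ∂ν = μ ^ r * ∫ x, φ x * g x ∂ν

/-- `h` is the function `f` (given up to `ν`-null sets) seen as an element of `H_K`: it is equal
to `f` almost everywhere, and it is the element of `H_K` of least norm with this property. If
the inclusion of `H_K` into `L²(ν)` is injective, for example if `ν` has full support, then
there is at most one element of `H_K` with the first property and the second one is void. -/
def IsVersion (K : MercerKernel X) (ν : Measure X) (f : X → ℝ) (h : K.HK) : Prop :=
  (∀ᵐ x ∂ν, h x = f x) ∧ ∀ h' : K.HK, (∀ᵐ x ∂ν, h' x = f x) → ‖h‖ ≤ ‖h'‖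

end MercerKernel

/-- The norm of `L²(ν)`. -/
def l2norm {X : Type*} [MeasurableSpace X] (ν : Measure X) (f : X → ℝ) : ℝ :=
  √(∫ x, |f x| ^ 2 ∂ν)

/-- The regression function `f_ρ(x) = ∫ y dρ(y | x)`. -/
def regressionFun {X : Type*} [MeasurableSpace X] (ρ : Measure (X × ℝ)) [IsFiniteMeasure ρ] :
    X → ℝ :=
  fun x => ∫ y, y ∂(ρ.condKernel x)

/-- The step sizes `γ_t = a (1 / (t + t₀))^{2r/(2r+1)}`. -/
def stepSeq (a t₀ r : ℝ) (t : ℕ) : ℝ := a * (1 / (t + t₀)) ^ (2 * r / (2 * r + 1))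

/-- The regularization parameters `λ_t = (1/a) (1 / (t + t₀))^{1/(2r+1)}`. -/
def regSeq (a t₀ r : ℝ) (t : ℕ) : ℝ := 1 / a * (1 / (t + t₀)) ^ (1 / (2 * r + 1))

end

/-! ### Exponential inequalities in Hilbert space -/

/-! Let `J : H_K → L²` be the inclusion, so that `L_K = J J†`, and let `F_λ` be the Tikhonov
solution, `(J†J + λ) F_λ = J† f_ρ`. With `F_t = F_{λ_t}`, the error splits as `f_t - f_ρ = W_t +
(f_t - F_t - W_t) + (F_t - f_ρ)`, where `W_t` starts at `0` and collects the noise.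

Approximation (`exists_regularization_path`). In an eigenbasis of the compact operator `J†J`, the
source condition gives `f_ρ` the coefficients `μ^(r-1/2) c_i` with `∑ c_i² ≤ ‖g‖²`. Since `r > 1/2`,
this series converges in `H_K`. The factors `μ/(μ+λ)` then give `‖F_λ - f_ρ‖ ≤ λ^(r-1/2) ‖g‖` and a
bound on `‖F_λ - F_λ'‖`.

Drift (`norm_sub_path_sub_noiseSeq_le`). A step acts on the error by the random operator `A = I - γ
(K_x ⊗ K_x + λ)`, and `t₀^θ ≥ a κ² + 1` forces `‖A‖ ≤ 1 - γ λ`. Since `γ_t λ_t = 1 / (t + t₀)`, the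
products of these bounds telescope: the initial error decays like `1 / (t + t₀)`, and the
displacements `F_t - F_{t+1}` add up to the order of the rate.

Noise (`measure_lt_norm_noiseSeq_le`). `W_{t+1} = A W_t + γ ξ`, where `ξ` is centred by the normal
equation and `E ‖ξ‖² ≤ κ² M²`. As `A` and `ξ` depend on the same sample, the moment `E cosh ‖S + A'
W_t‖` is bounded for all vectors `S` and operators `A'` at once
(`lintegral_cosh_norm_recursion_le`). Markov's inequality then gives tails with a single logarithm
of `1/δ`, and Borel–Cantelli gives almost sure convergence. -/

lemma convexOn_cosh_sqrt : ConvexOn ℝ (Set.Ici 0) fun u : ℝ => Real.cosh √u := by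
  refine ⟨convex_Ici 0, fun u hu v hv α β hα hβ hαβ => ?_⟩
  have hs : ∀ w : ℝ, 0 ≤ w →
      HasSum (fun n : ℕ => w ^ n / ((2 * n).factorial : ℝ)) (Real.cosh √w) := fun w hw => by
    simpa [pow_mul, Real.sq_sqrt hw] using Real.hasSum_cosh √w
  have hw : 0 ≤ α • u + β • v := (convex_Ici (0 : ℝ)) hu hv hα hβ hαβ
  -- The power series `∑ u ^ n / (2 n)!` has nonnegative coefficients, so convexity of each monomial
  -- on `[0, ∞)` suffices.
  refine hasSum_le (fun n => ?_) (hs _ hw) (((hs u hu).const_smul α).add ((hs v hv).const_smul β))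
  have h := (convexOn_pow (𝕜 := ℝ) n).2 hu hv hα hβ hαβ
  simp only [smul_eq_mul] at h ⊢
  rw [mul_div_assoc', mul_div_assoc', ← add_div]
  gcongr

/-- Expanding by the addition formula, `sinh x ≤ cosh x` and `y ≤ sinh y` bound the remainder by
`cosh x * (exp y - 1 - y)`, and `exp y - 1 - y ≤ y ^ 2` on `[0, 1]`. -/
lemma cosh_add_le_of_le_one {x y : ℝ} (hy : 0 ≤ y) (hy1 : y ≤ 1) :
    Real.cosh (x + y) ≤ Real.cosh x + y * Real.sinh x + y ^ 2 * Real.cosh x := by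
  have h2 : Real.exp y - 1 - y ≤ y ^ 2 :=
    (le_abs_self _).trans (Real.abs_exp_sub_one_sub_id_le (by rwa [abs_of_nonneg hy]))
  have h3 : y ≤ Real.sinh y := Real.self_le_sinh_iff.2 hy
  have h4 : Real.sinh x ≤ Real.cosh x := (Real.sinh_lt_cosh x).le
  have h5 := Real.cosh_add_sinh y
  rw [Real.cosh_add]
  nlinarith [mul_nonneg (sub_nonneg.2 h3) (sub_nonneg.2 h4), Real.cosh_pos x]

lemma cosh_sub_le_of_le_one {x y : ℝ} (hx : 0 ≤ x) (hy : 0 ≤ y) (hy1 : y ≤ 1) :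
    Real.cosh (x - y) ≤ Real.cosh x - y * Real.sinh x + y ^ 2 * Real.cosh x := by
  have h2 : Real.exp y - 1 - y ≤ y ^ 2 :=
    (le_abs_self _).trans (Real.abs_exp_sub_one_sub_id_le (by rwa [abs_of_nonneg hy]))
  have h3 : y ≤ Real.sinh y := Real.self_le_sinh_iff.2 hy
  have h4 : 0 ≤ Real.sinh x := Real.sinh_nonneg_iff.2 hx
  have h5 := Real.cosh_add_sinh y
  rw [Real.cosh_sub]
  nlinarith [mul_nonneg (sub_nonneg.2 h3) h4, Real.cosh_pos x]

/-- The state of a random recursion driven by an independent sequence is a measurable function of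
the past, hence independent of the next input. -/
lemma indepFun_of_recursion {E Z Ω : Type*} [MeasurableSpace E] [MeasurableSpace Z]
    [MeasurableSpace Ω] {P : Measure Ω} [IsProbabilityMeasure P] {z : ℕ → Ω → Z}
    (hz_meas : ∀ i, Measurable (z i)) (hz_indep : iIndepFun z P) {G : ℕ → E × Z → E}
    (hG : ∀ k, Measurable (G k)) {W : ℕ → Ω → E} {w₀ : E} (hW0 : ∀ ω, W 0 ω = w₀)
    (hW : ∀ k ω, W (k + 1) ω = G k (W k ω, z k ω)) (k : ℕ) :
    Measurable (W k) ∧ IndepFun (W k) (z k) P := by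
  have hΦ : ∀ k, ∃ Φ : (Finset.range k → Z) → E, Measurable Φ ∧
      ∀ ω, W k ω = Φ fun i => z i ω := by
    intro k
    induction k with
    | zero => exact ⟨fun _ => w₀, measurable_const, hW0⟩
    | succ k ih =>
      obtain ⟨Φ, hΦ, hΦW⟩ := ih
      refine ⟨fun u => G k (Φ (fun i => u ⟨i, Finset.mem_range.2
        ((Finset.mem_range.1 i.2).trans (Nat.lt_succ_self k))⟩),
        u ⟨k, Finset.self_mem_range_succ k⟩), ?_, fun ω => by rw [hW, hΦW]⟩
      refine (hG k).comp ((hΦ.comp (measurable_pi_lambda _ fun i => ?_)).prodMk ?_)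
      · exact measurable_pi_apply _
      · exact measurable_pi_apply _
  obtain ⟨Φ, hΦ, hΦW⟩ := hΦ k
  have hWΦ : W k = Φ ∘ fun ω (i : Finset.range k) => z i ω := funext hΦW
  have hmeas : Measurable fun ω (i : Finset.range k) => z i ω :=
    measurable_pi_lambda _ fun i => hz_meas i
  refine ⟨hWΦ ▸ hΦ.comp hmeas, ?_⟩
  have hdisj : Disjoint (Finset.range k) {k} := by simp
  have h := hz_indep.indepFun_finset (Finset.range k) {k} hdisj hz_meas
  have h' := h.comp (φ := Φ) (ψ := fun u => u ⟨k, Finset.mem_singleton_self k⟩) hΦ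
    (measurable_pi_apply (X := fun _ : ({k} : Finset ℕ) => Z) ⟨k, Finset.mem_singleton_self k⟩)
  rw [hWΦ]
  exact h'

section Hilbert

variable {H : Type*} [NormedAddCommGroup H] [InnerProductSpace ℝ H]

/-- A second order expansion of `cosh ‖·‖`. -/
lemma cosh_norm_add_le (s d : H) (hd : ‖d‖ ≤ 1) :
    Real.cosh ‖s + d‖ ≤ Real.cosh ‖s‖ + Real.sinh ‖s‖ / ‖s‖ * inner ℝ s d
      + ‖d‖ ^ 2 * Real.cosh ‖s‖ := by
  rcases eq_or_ne s 0 with rfl | hs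
  · simpa using cosh_add_le_of_le_one (x := 0) (norm_nonneg d) hd
  rcases eq_or_ne d 0 with rfl | hd0
  · simp
  have ha : 0 < ‖s‖ := norm_pos_iff.2 hs
  have hD : 0 < ‖d‖ := norm_pos_iff.2 hd0
  set x := ‖s‖
  set y := ‖d‖
  have hp := abs_le.1 (abs_real_inner_le_norm s d)
  set p := inner ℝ s d
  -- `‖s + d‖ ^ 2` is the convex combination, with weights `α` and `β`, of its extreme values `(x +
  -- y) ^ 2` and `(x - y) ^ 2`. Convexity of `cosh √·` thus reduces the claim to parallel vectors.
  set α := (1 + p / (x * y)) / 2 with hα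
  set β := (1 - p / (x * y)) / 2 with hβ
  have hxy : 0 < x * y := mul_pos ha hD
  have hq1 : p / (x * y) ≤ 1 := (div_le_one hxy).2 hp.2
  have hq2 : -1 ≤ p / (x * y) := (le_div_iff₀ hxy).2 (by linarith [hp.1])
  have hα0 : 0 ≤ α := by rw [hα]; linarith
  have hβ0 : 0 ≤ β := by rw [hβ]; linarith
  have hαβ : α + β = 1 := by rw [hα, hβ]; ring
  have hdiff : (α - β) * (x * y) = p := by
    rw [hα, hβ]; field_simp; ring
  have hnorm : ‖s + d‖ = √(α * (x + y) ^ 2 + β * (x - y) ^ 2) := by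
    rw [eq_comm, Real.sqrt_eq_iff_mul_self_eq (by positivity) (norm_nonneg _), ← pow_two,
      norm_add_sq_real]
    change _ = x ^ 2 + 2 * p + y ^ 2
    rw [← hdiff]
    linear_combination (-(x ^ 2 + y ^ 2)) * hαβ
  have hconv := convexOn_cosh_sqrt.2 (sq_nonneg (x + y)) (sq_nonneg (x - y)) hα0 hβ0 hαβ
  simp only [smul_eq_mul, Real.sqrt_sq_eq_abs, Real.cosh_abs] at hconv
  rw [hnorm]
  refine hconv.trans ?_
  have h1 := mul_le_mul_of_nonneg_left (cosh_add_le_of_le_one (x := x) hD.le hd) hα0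
  have h2 := mul_le_mul_of_nonneg_left (cosh_sub_le_of_le_one ha.le hD.le hd) hβ0
  have h3 : Real.sinh x / x * p = (α - β) * (y * Real.sinh x) := by
    rw [← hdiff]; field_simp
  rw [h3]
  have hβ' : β = 1 - α := by linarith
  rw [hβ'] at h2 ⊢
  linarith

variable {Ω : Type*} [MeasurableSpace Ω]

/-- The tail bound that follows from an exponential moment bound. -/
lemma measure_norm_recursion_le {P : Measure Ω} [MeasurableSpace H] [BorelSpace H] {W : Ω → H}
    (hWm : Measurable W) {D m v : ℝ}
    (hD : 0 < D) (hmD : m ≤ D) (hvD : v ≤ D ^ 2)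
    (hexp : ∀ (p : ℝ) (S : H) (A : H →L[ℝ] H), ‖A‖ ≤ p → p * m ≤ 1 →
      ∫⁻ ω, ENNReal.ofReal (Real.cosh ‖S + A (W ω)‖) ∂P
        ≤ ENNReal.ofReal (Real.cosh ‖S‖ * Real.exp (p ^ 2 * v)))
    {δ : ℝ} (hδ : 0 < δ) :
    P {ω | D * (1 + Real.log (2 / δ)) ≤ ‖W ω‖} ≤ ENNReal.ofReal δ := by
  have hA : ‖D⁻¹ • ContinuousLinearMap.id ℝ H‖ ≤ D⁻¹ := by
    rw [norm_smul, Real.norm_of_nonneg (by positivity)]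
    exact mul_le_of_le_one_right (by positivity) ContinuousLinearMap.norm_id_le
  -- The choice `p = 1 / D` keeps the moment below `e`, while `cosh (1 + L) ≥ exp (1 + L) / 2 = e /
  -- δ`: the quotient is exactly `δ`.
  have h := hexp D⁻¹ 0 (D⁻¹ • ContinuousLinearMap.id ℝ H) hA
    (by rw [inv_mul_le_iff₀ hD]; linarith)
  simp only [zero_add, norm_zero, Real.cosh_zero, one_mul] at h
  set L := Real.log (2 / δ)
  have hmeas : Measurable fun ω => ENNReal.ofReal
      (Real.cosh ‖(D⁻¹ • ContinuousLinearMap.id ℝ H) (W ω)‖) :=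
    ENNReal.measurable_ofReal.comp (Real.continuous_cosh.measurable.comp
      ((ContinuousLinearMap.continuous _).measurable.comp hWm).norm)
  have hexpL : Real.exp (1 + L) / 2 = Real.exp 1 / δ := by
    rw [Real.exp_add, Real.exp_log (by positivity)]; ring
  have hsub : {ω | D * (1 + L) ≤ ‖W ω‖} ⊆ {ω | ENNReal.ofReal (Real.exp 1 / δ) ≤
      ENNReal.ofReal (Real.cosh ‖(D⁻¹ • ContinuousLinearMap.id ℝ H) (W ω)‖)} := by
    intro ω hω
    refine ENNReal.ofReal_le_ofReal ?_
    rw [← hexpL]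
    have h1 : ‖(D⁻¹ • ContinuousLinearMap.id ℝ H) (W ω)‖ = D⁻¹ * ‖W ω‖ := by
      simp [norm_smul, abs_of_pos hD]
    have h2 : 1 + L ≤ D⁻¹ * ‖W ω‖ := by
      rw [le_inv_mul_iff₀ hD]; exact hω
    rw [h1, Real.cosh_eq]
    have := Real.exp_le_exp.2 h2
    have := Real.exp_pos (-(D⁻¹ * ‖W ω‖))
    linarith
  refine (measure_mono hsub).trans ?_
  refine (meas_ge_le_lintegral_div hmeas.aemeasurable
    (by simpa using div_pos (Real.exp_pos 1) hδ) ENNReal.ofReal_ne_top).trans ?_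
  rw [ENNReal.div_le_iff (by simpa using div_pos (Real.exp_pos 1) hδ) ENNReal.ofReal_ne_top,
    ← ENNReal.ofReal_mul hδ.le]
  refine h.trans (ENNReal.ofReal_le_ofReal ?_)
  rw [mul_div_cancel₀ _ hδ.ne']
  refine Real.exp_le_exp.2 ?_
  rw [inv_pow, inv_mul_le_iff₀ (by positivity)]
  linarith

/-- This admits `D = 0`, which occurs when `M = 0`. The strict event is the increasing union of the
events with `D + 1 / (n + 1)` in place of `D`. -/
lemma measure_lt_norm_recursion_le [MeasurableSpace H] [BorelSpace H] {W : Ω → H}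
    (hWm : Measurable W) {P : Measure Ω} {D m v : ℝ} (hD : 0 ≤ D) (hmD : m ≤ D) (hvD : v ≤ D ^ 2)
    (hexp : ∀ (p : ℝ) (S : H) (A : H →L[ℝ] H), ‖A‖ ≤ p → p * m ≤ 1 →
      ∫⁻ ω, ENNReal.ofReal (Real.cosh ‖S + A (W ω)‖) ∂P
        ≤ ENNReal.ofReal (Real.cosh ‖S‖ * Real.exp (p ^ 2 * v)))
    {δ : ℝ} (hδ : δ ∈ Set.Ioo (0 : ℝ) 1) :
    P {ω | D * (1 + Real.log (2 / δ)) < ‖W ω‖} ≤ ENNReal.ofReal δ := by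
  have hL : 0 < 1 + Real.log (2 / δ) := by
    have : 0 < Real.log (2 / δ) := Real.log_pos ((one_lt_div hδ.1).2 (by linarith [hδ.2]))
    linarith
  set L := 1 + Real.log (2 / δ)
  have hsub : {ω | D * L < ‖W ω‖} ⊆ ⋃ n : ℕ, {ω | (D + 1 / ((n : ℝ) + 1)) * L ≤ ‖W ω‖} := by
    intro ω hω
    obtain ⟨n, hn⟩ := exists_nat_one_div_lt (div_pos (sub_pos.2 hω) hL)
    refine Set.mem_iUnion.2 ⟨n, ?_⟩
    have := (lt_div_iff₀ hL).1 hn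
    change (D + 1 / ((n : ℝ) + 1)) * L ≤ ‖W ω‖
    linarith
  refine (measure_mono hsub).trans ?_
  rw [Monotone.measure_iUnion]
  · refine iSup_le fun n => ?_
    have hn : (0 : ℝ) < 1 / ((n : ℝ) + 1) := by positivity
    exact measure_norm_recursion_le hWm (by linarith) (by linarith) (hvD.trans (by gcongr; linarith))
      hexp hδ.1
  · intro n k hnk ω hω
    change (D + 1 / ((n : ℝ) + 1)) * L ≤ ‖W ω‖ at hω
    change (D + 1 / ((k : ℝ) + 1)) * L ≤ ‖W ω‖
    refine le_trans ?_ hω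
    have : (1 : ℝ) / (k + 1) ≤ 1 / (n + 1) := by gcongr
    gcongr

variable [CompleteSpace H] {Z : Type*} [MeasurableSpace Z]

/-- A centred bounded perturbation increases the mean of `cosh ‖·‖` at most by a factor
`1 + E ‖η‖ ^ 2`. -/
lemma lintegral_cosh_norm_add_le (ρ : Measure Z) [IsProbabilityMeasure ρ] (S : H) {η : Z → H}
    (hη : AEStronglyMeasurable η ρ) (hbd : ∀ᵐ z ∂ρ, ‖η z‖ ≤ 1) (hmean : ∫ z, η z ∂ρ = 0) :
    ∫⁻ z, ENNReal.ofReal (Real.cosh ‖S + η z‖) ∂ρ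
      ≤ ENNReal.ofReal (Real.cosh ‖S‖ * Real.exp (∫ z, ‖η z‖ ^ 2 ∂ρ)) := by
  have hint : Integrable η ρ := Integrable.of_bound hη 1 hbd
  have hint2 : Integrable (fun z => ‖η z‖ ^ 2) ρ := by
    refine Integrable.of_bound (hη.norm.pow 2) 1 (hbd.mono fun z hz => ?_)
    rw [Real.norm_of_nonneg (by positivity)]
    exact pow_le_one₀ (norm_nonneg _) hz
  have hle : ∀ᵐ z ∂ρ, Real.cosh ‖S + η z‖ ≤ Real.cosh ‖S‖ + Real.sinh ‖S‖ / ‖S‖ * inner ℝ S (η z)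
      + ‖η z‖ ^ 2 * Real.cosh ‖S‖ := hbd.mono fun z hz => cosh_norm_add_le S _ hz
  have hi1 : Integrable (fun z => Real.sinh ‖S‖ / ‖S‖ * inner ℝ S (η z)) ρ :=
    (hint.const_inner S).const_mul _
  have hi2 := hint2.mul_const (Real.cosh ‖S‖)
  have hi01 : Integrable (fun z => Real.cosh ‖S‖ + Real.sinh ‖S‖ / ‖S‖ * inner ℝ S (η z)) ρ :=
    (integrable_const _).add hi1
  have hi : Integrable (fun z => Real.cosh ‖S‖ + Real.sinh ‖S‖ / ‖S‖ * inner ℝ S (η z)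
      + ‖η z‖ ^ 2 * Real.cosh ‖S‖) ρ := hi01.add hi2
  calc ∫⁻ z, ENNReal.ofReal (Real.cosh ‖S + η z‖) ∂ρ
      ≤ ∫⁻ z, ENNReal.ofReal (Real.cosh ‖S‖ + Real.sinh ‖S‖ / ‖S‖ * inner ℝ S (η z)
          + ‖η z‖ ^ 2 * Real.cosh ‖S‖) ∂ρ :=
        lintegral_mono_ae (hle.mono fun z hz => ENNReal.ofReal_le_ofReal hz)
    _ = ENNReal.ofReal (∫ z, (Real.cosh ‖S‖ + Real.sinh ‖S‖ / ‖S‖ * inner ℝ S (η z)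
          + ‖η z‖ ^ 2 * Real.cosh ‖S‖) ∂ρ) :=
        (ofReal_integral_eq_lintegral_ofReal hi
          (hle.mono fun z hz => (Real.cosh_pos _).le.trans hz)).symm
    _ = ENNReal.ofReal (Real.cosh ‖S‖ * (∫ z, ‖η z‖ ^ 2 ∂ρ + 1)) := by
        rw [integral_add hi01 hi2,
          integral_add (integrable_const _) hi1, integral_const_mul, integral_inner hint,
          hmean, integral_mul_const]
        congr 1
        simp
        ring
    _ ≤ _ := by
        have := Real.cosh_pos ‖S‖
        gcongr
        exact Real.add_one_le_exp _

variable [MeasurableSpace H] [BorelSpace H] [SecondCountableTopology H]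

/-- An exponential moment bound for the linear random recursion
`W (k + 1) = B k (z k) (W k) + η k (z k)` with independent inputs and centred noise. -/
lemma lintegral_cosh_norm_recursion_le {P : Measure Ω} [IsProbabilityMeasure P]
    {ρ : Measure Z} [IsProbabilityMeasure ρ] {z : ℕ → Ω → Z}
    (hz_meas : ∀ i, Measurable (z i)) (hz_indep : iIndepFun z P) (hz_law : ∀ i, P.map (z i) = ρ)
    {B : ℕ → Z → H →L[ℝ] H} {η : ℕ → Z → H}
    (hB : ∀ k, Measurable fun q : H × Z => B k q.2 q.1) (hη : ∀ k, Measurable (η k))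
    {β m v : ℕ → ℝ} (hBβ : ∀ k u, ‖B k u‖ ≤ β k) (hv0 : 0 ≤ v 0)
    (hmβ : ∀ k, β k * m k ≤ m (k + 1)) (hηm : ∀ k, ∀ᵐ u ∂ρ, ‖η k u‖ ≤ m (k + 1))
    (hmean : ∀ k, ∫ u, η k u ∂ρ = 0)
    (hvβ : ∀ k, β k ^ 2 * v k + ∫ u, ‖η k u‖ ^ 2 ∂ρ ≤ v (k + 1))
    {W : ℕ → Ω → H} (hW0 : ∀ ω, W 0 ω = 0)
    (hW : ∀ k ω, W (k + 1) ω = B k (z k ω) (W k ω) + η k (z k ω)) (k : ℕ) :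
    ∀ (p : ℝ) (S : H) (A : H →L[ℝ] H), ‖A‖ ≤ p → p * m k ≤ 1 →
      ∫⁻ ω, ENNReal.ofReal (Real.cosh ‖S + A (W k ω)‖) ∂P
        ≤ ENNReal.ofReal (Real.cosh ‖S‖ * Real.exp (p ^ 2 * v k)) := by
  -- Quantifying over `S` and `A` makes the induction close: once the last input is fixed, its noise
  -- is absorbed into `S` and its operator into `A`, so only a norm bound on `B` is needed and its
  -- correlation with `η` is harmless.
  induction k with
  | zero =>
    intro p S A hA hp
    simp only [hW0, map_zero, add_zero, lintegral_const, measure_univ, mul_one]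
    refine ENNReal.ofReal_le_ofReal (le_mul_of_one_le_right (Real.cosh_pos _).le ?_)
    exact Real.one_le_exp (by positivity)
  | succ k ih =>
    intro p S A hA hpm
    have hp : 0 ≤ p := (norm_nonneg _).trans hA
    obtain ⟨hWm, hWi⟩ := indepFun_of_recursion hz_meas hz_indep
      (G := fun k q => B k q.2 q.1 + η k q.2)
      (fun k => (hB k).add ((hη k).comp measurable_snd)) hW0 hW k
    have hprod : P.map (fun ω => (W k ω, z k ω)) = (P.map (W k)).prod ρ := by
      rw [(indepFun_iff_map_prod_eq_prod_map_map hWm.aemeasurable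
        (hz_meas k).aemeasurable).1 hWi, hz_law]
    set g : H × Z → ENNReal := fun q =>
      ENNReal.ofReal (Real.cosh ‖(S + A (η k q.2)) + A (B k q.2 q.1)‖) with hg
    have hgm : Measurable g := by
      refine ENNReal.measurable_ofReal.comp (Real.continuous_cosh.measurable.comp
        (Measurable.norm (Measurable.add (measurable_const.add ?_) ?_)))
      · exact A.continuous.measurable.comp ((hη k).comp measurable_snd)
      · exact A.continuous.measurable.comp (hB k)
    have hβ : 0 ≤ β k := by
      obtain ⟨u⟩ : Nonempty Z := nonempty_of_isProbabilityMeasure ρ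
      exact (norm_nonneg _).trans (hBβ k u)
    have : IsProbabilityMeasure (P.map (W k)) := Measure.isProbabilityMeasure_map hWm.aemeasurable
    calc ∫⁻ ω, ENNReal.ofReal (Real.cosh ‖S + A (W (k + 1) ω)‖) ∂P
        = ∫⁻ ω, g (W k ω, z k ω) ∂P := by
          refine lintegral_congr fun ω => ?_
          rw [hg, hW, map_add]
          simp only
          congr 3
          abel
      _ = ∫⁻ u, ∫⁻ ω, g (W k ω, u) ∂P ∂ρ := by
          rw [← lintegral_map hgm (hWm.prodMk (hz_meas k)), hprod,
            lintegral_prod_symm _ hgm.aemeasurable]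
          refine lintegral_congr fun u => ?_
          exact lintegral_map (f := fun w => g (w, u)) (hgm.comp measurable_prodMk_right) hWm
      _ ≤ ∫⁻ u, ENNReal.ofReal (Real.cosh ‖S + A (η k u)‖) *
            ENNReal.ofReal (Real.exp ((p * β k) ^ 2 * v k)) ∂ρ := by
          refine lintegral_mono fun u => ?_
          rw [← ENNReal.ofReal_mul (Real.cosh_pos _).le]
          refine ih (p * β k) (S + A (η k u)) (A.comp (B k u)) ?_ ?_
          · exact (A.opNorm_comp_le _).trans
              (mul_le_mul hA (hBβ k u) (norm_nonneg _) hp)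
          · rw [mul_assoc]
            exact (mul_le_mul_of_nonneg_left (hmβ k) hp).trans hpm
      _ ≤ ENNReal.ofReal (Real.cosh ‖S‖ * Real.exp (∫ u, ‖A (η k u)‖ ^ 2 ∂ρ)) *
            ENNReal.ofReal (Real.exp ((p * β k) ^ 2 * v k)) := by
          rw [lintegral_mul_const' _ _ ENNReal.ofReal_ne_top]
          gcongr
          refine lintegral_cosh_norm_add_le ρ S
            (A.continuous.measurable.comp (hη k)).aestronglyMeasurable
            ((hηm k).mono fun u hu => ?_) ?_
          · exact (A.le_of_opNorm_le_of_le hA hu).trans hpm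
          · rw [A.integral_comp_comm
              (Integrable.of_bound (hη k).aestronglyMeasurable _ (hηm k)), hmean, map_zero]
      _ ≤ ENNReal.ofReal (Real.cosh ‖S‖ * Real.exp (p ^ 2 * v (k + 1))) := by
          rw [← ENNReal.ofReal_mul (by positivity [Real.cosh_pos ‖S‖]), mul_assoc, ← Real.exp_add]
          refine ENNReal.ofReal_le_ofReal (mul_le_mul_of_nonneg_left
            (Real.exp_le_exp.2 ?_) (Real.cosh_pos _).le)
          have hle : ∫ u, ‖A (η k u)‖ ^ 2 ∂ρ ≤ p ^ 2 * ∫ u, ‖η k u‖ ^ 2 ∂ρ := by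
            rw [← integral_const_mul]
            refine integral_mono_of_nonneg (Eventually.of_forall fun u => by positivity) ?_
              (Eventually.of_forall fun u => ?_)
            · refine Integrable.const_mul (Integrable.of_bound
                ((hη k).norm.pow_const 2).aestronglyMeasurable (m (k + 1) ^ 2)
                ((hηm k).mono fun u hu => ?_)) _
              rw [Real.norm_of_nonneg (by positivity)]
              gcongr
            · simp only [← mul_pow]
              gcongr
              exact A.le_of_opNorm_le hA _
          nlinarith [mul_le_mul_of_nonneg_left (hvβ k) (sq_nonneg p)]

end Hilbert

/-! ### Source conditions for compact operators -/

section Spectral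

universe u

variable {H : Type u} [NormedAddCommGroup H] [InnerProductSpace ℝ H]

lemma Orthonormal.inner_eq_of_hasSum {ι : Type*} {b : ι → H} (hb : Orthonormal ℝ b) {d : ι → ℝ}
    {x : H} (hx : HasSum (fun i => d i • b i) x) (i : ι) : inner ℝ (b i) x = d i := by
  classical
  have h1 := (innerSL ℝ (b i)).hasSum hx
  have h2 : HasSum (fun j => if j = i then d i else 0) (d i) := hasSum_ite_eq i (d i)
  have h3 : (fun j => innerSL ℝ (b i) (d j • b j)) = fun j => if j = i then d i else 0 := by
    funext j
    rw [innerSL_apply_apply, real_inner_smul_right]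
    split_ifs with hij
    · subst hij
      rw [real_inner_self_eq_norm_sq, hb.1 j]; ring
    · rw [hb.2 (Ne.symm hij), mul_zero]
  rw [h3] at h1
  exact h1.unique h2

/-- A bounded diagonal operator applied to a square-summable family. -/
lemma Orthonormal.norm_le_of_hasSum {ι : Type*} {b : ι → H} (hb : Orthonormal ℝ b)
    {c d : ι → ℝ} {C G : ℝ} (hC : 0 ≤ C) (hG : 0 ≤ G) (hc : Summable fun i => c i ^ 2)
    (hcG : ∑' i, c i ^ 2 ≤ G ^ 2) (hd : ∀ i, |d i| ≤ C * |c i|) {x : H}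
    (hx : HasSum (fun i => d i • b i) x) : ‖x‖ ≤ C * G := by
  have hle : ∀ i, d i ^ 2 ≤ C ^ 2 * c i ^ 2 := fun i => by
    rw [← sq_abs (d i), ← sq_abs (c i), ← mul_pow]
    exact pow_le_pow_left₀ (abs_nonneg _) (hd i) 2
  have hn : HasSum (fun i => d i ^ 2) (‖x‖ ^ 2) := by
    refine (hx.norm.pow 2).congr fun s => ?_
    have := hb.orthogonalFamily.norm_sum d s
    simp only [LinearIsometry.toSpanSingleton_apply, Real.norm_eq_abs, sq_abs] at this
    exact this
  have h2 : ‖x‖ ^ 2 ≤ (C * G) ^ 2 := by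
    rw [← hn.tsum_eq, mul_pow]
    calc ∑' i, d i ^ 2 ≤ ∑' i, C ^ 2 * c i ^ 2 := hn.summable.tsum_le_tsum hle (hc.mul_left _)
      _ = C ^ 2 * ∑' i, c i ^ 2 := tsum_mul_left
      _ ≤ _ := by gcongr
  exact le_of_sq_le_sq h2 (by positivity)

variable [CompleteSpace H]

/-- A compact self-adjoint operator has a complete orthonormal system of eigenvectors. -/
lemma exists_orthonormal_eigenvectors {T : H →L[ℝ] H} (hT : IsCompactOperator T)
    (hsymm : (T : H →ₗ[ℝ] H).IsSymmetric) :
    ∃ (ι : Type u) (b : ι → H) (μ : ι → ℝ), Orthonormal ℝ b ∧ (∀ i, T (b i) = μ i • b i) ∧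
      ∀ x, (∀ i, inner ℝ (b i) x = 0) → x = 0 := by
  -- Each eigenspace is closed, hence has a Hilbert basis. The eigenvalue `0` is included, so the
  -- union of these bases is complete.
  have hc : ∀ μ : ℝ, CompleteSpace (Module.End.eigenspace (T : H →ₗ[ℝ] H) μ) := fun μ => by
    refine IsClosed.completeSpace_coe (hs := ?_)
    have : ((Module.End.eigenspace (T : H →ₗ[ℝ] H) μ : Submodule ℝ H) : Set H)
        = {x | T x = μ • x} := by
      ext x; simp
    rw [this]
    exact isClosed_eq T.continuous (continuous_const_smul μ)
  choose w e he using fun μ : ℝ =>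
    exists_hilbertBasis ℝ (Module.End.eigenspace (T : H →ₗ[ℝ] H) μ)
  refine ⟨Σ μ : ℝ, w μ, fun a => (e a.1 a.2 : H), fun a => a.1, ?_, fun a => ?_, fun x hx => ?_⟩
  · exact hsymm.orthogonalFamily_eigenspaces.orthonormal_sigma_orthonormal
      fun μ => (e μ).orthonormal
  · exact Module.End.mem_eigenspace_iff.1 (e a.1 a.2).2
  · have hbot := ContinuousLinearMap.orthogonalComplement_iSup_eigenspaces_eq_bot hT hsymm
    have hmem : x ∈ (⨆ μ, Module.End.eigenspace (T : H →ₗ[ℝ] H) μ)ᗮ := by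
      rw [← Submodule.iInf_orthogonal, Submodule.mem_iInf]
      intro μ
      rw [Submodule.mem_orthogonal']
      intro u hu
      have h1 := ((innerSL ℝ x).comp (Submodule.subtypeL _)).hasSum ((e μ).hasSum_repr ⟨u, hu⟩)
      refine h1.unique ?_
      convert hasSum_zero using 2 with i
      have h0 : inner ℝ x (e μ i : H) = 0 := by
        rw [real_inner_comm]; exact hx ⟨μ, i⟩
      simp [h0]
    rw [hbot] at hmem
    exact (Submodule.mem_bot ℝ).1 hmem

lemma Orthonormal.summable_smul_of_sq {ι : Type*} {b : ι → H} (hb : Orthonormal ℝ b) {d : ι → ℝ}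
    (hd : Summable fun i => d i ^ 2) : Summable fun i => d i • b i := by
  have := hb.orthogonalFamily.summable_iff_norm_sq_summable d
  simp only [LinearIsometry.toSpanSingleton_apply, Real.norm_eq_abs, sq_abs] at this
  exact this.2 hd

lemma summable_sq_of_abs_le {ι : Type*} {c d : ι → ℝ} {C : ℝ} (hc : Summable fun i => c i ^ 2)
    (hd : ∀ i, |d i| ≤ C * |c i|) : Summable fun i => d i ^ 2 := by
  refine Summable.of_nonneg_of_le (fun i => sq_nonneg _) (fun i => ?_) (hc.mul_left (C ^ 2))
  rw [← sq_abs (d i), ← sq_abs (c i), ← mul_pow]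
  exact pow_le_pow_left₀ (abs_nonneg _) (hd i) 2

/-- Weighted AM-GM. It is used with `p = r - 1 / 2`, and the requirement `p ≤ 1` is the saturation
limit `r ≤ 3 / 2`. -/
lemma rpow_mul_rpow_one_sub_le_add {s l p : ℝ} (hs : 0 ≤ s) (hl : 0 ≤ l) (hp0 : 0 ≤ p)
    (hp1 : p ≤ 1) : s ^ p * l ^ (1 - p) ≤ s + l := by
  have := Real.geom_mean_le_arith_mean2_weighted hp0 (sub_nonneg.2 hp1) hs hl (by ring)
  nlinarith

variable {V : Type*} [NormedAddCommGroup V] [InnerProductSpace ℝ V] [CompleteSpace V]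

open ContinuousLinearMap in
/-- Under the source condition `f = (J J†) ^ r g` with `r ∈ (1/2, 3/2]`, the equation `J h = f`
has a solution in `(ker J)ᗮ`, and the Tikhonov regularization path converges to it with the
usual rates. -/
lemma exists_regularization_path {J : H →L[ℝ] V} (hT : IsCompactOperator (adjoint J ∘L J))
    (hinj : ∀ v, adjoint J v = 0 → v = 0) {r : ℝ} (hr0 : 1 / 2 < r) (hr1 : r ≤ 3 / 2) {f g : V}
    (hfg : ∀ (μ : ℝ) (b : H), adjoint J (J b) = μ • b → inner ℝ (J b) f = μ ^ r * inner ℝ (J b) g) :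
    ∃ h : H, J h = f ∧ (∀ w, J w = 0 → inner ℝ h w = 0) ∧ ∃ F : ℝ → H, ∀ l, 0 < l →
      adjoint J (J (F l)) + l • F l = adjoint J f ∧ ‖F l - h‖ ≤ l ^ (r - 1 / 2) * ‖g‖ ∧
      ∀ m, l ≤ m → ‖F l - F m‖ ≤ (m - l) * m ^ (r - 3 / 2) * ‖g‖ := by
  set T : H →L[ℝ] H := adjoint J ∘L J with hTdef
  have hTinner : ∀ x y, inner ℝ (T x) y = inner ℝ (J x) (J y) := fun x y => by
    rw [hTdef, comp_apply, adjoint_inner_left]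
  have hsymm : (T : H →ₗ[ℝ] H).IsSymmetric := fun x y => by
    change inner ℝ (T x) y = inner ℝ x (T y)
    rw [hTinner, real_inner_comm, ← hTinner, real_inner_comm]
  obtain ⟨κ, b₀, μ₀, hb₀, hTb₀, hcompl⟩ := exists_orthonormal_eigenvectors hT hsymm
  have hμJ : ∀ i j, inner ℝ (J (b₀ i)) (J (b₀ j)) = μ₀ i * inner ℝ (b₀ i) (b₀ j) := fun i j => by
    rw [← hTinner, hTb₀, real_inner_smul_left]
  have hμ₀ : ∀ i, μ₀ i = ‖J (b₀ i)‖ ^ 2 := fun i => by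
    rw [← real_inner_self_eq_norm_sq, hμJ, real_inner_self_eq_norm_sq, hb₀.1 i]; ring
  set b : {i // 0 < μ₀ i} → H := fun i => b₀ i with hbdef
  set μ : {i // 0 < μ₀ i} → ℝ := fun i => μ₀ i with hμdef
  have hμ : ∀ i, 0 < μ i := fun i => i.2
  have hb : Orthonormal ℝ b := hb₀.comp _ Subtype.val_injective
  have hTb : ∀ i, T (b i) = μ i • b i := fun i => hTb₀ i
  have hμT : ∀ i, μ i ≤ ‖T‖ := fun i => by
    have := T.le_opNorm (b i)
    rwa [hTb, norm_smul, hb.1 i, mul_one, mul_one, Real.norm_of_nonneg (hμ i).le] at this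
  have he : Orthonormal ℝ fun i => (√(μ i))⁻¹ • J (b i) := by
    constructor
    · intro i
      rw [norm_smul, norm_inv, Real.norm_of_nonneg (Real.sqrt_nonneg _)]
      have : ‖J (b i)‖ = √(μ i) := by
        rw [hμdef]; simp only; rw [hμ₀, Real.sqrt_sq (norm_nonneg _)]
      rw [this, inv_mul_cancel₀ (Real.sqrt_pos.2 (hμ i)).ne']
    · intro i j hij
      change inner ℝ ((√(μ i))⁻¹ • J (b i)) ((√(μ j))⁻¹ • J (b j)) = 0
      rw [real_inner_smul_left, real_inner_smul_right, hμJ, hb₀.2 (Subtype.coe_injective.ne hij)]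
      ring
  -- Coefficients of `g` in the orthonormal system `J b / √μ` of `V`. There `f` has the coefficients
  -- `μ ^ r * c`, and `J` multiplies coefficients by `√μ`, so the solution must have the
  -- coefficients `μ ^ (r - 1 / 2) * c`.
  set c : {i // 0 < μ₀ i} → ℝ := fun i => inner ℝ ((√(μ i))⁻¹ • J (b i)) g with hcdef
  have hJg : ∀ i, inner ℝ (J (b i)) g = √(μ i) * c i := fun i => by
    rw [hcdef]; simp only
    rw [real_inner_smul_left, mul_inv_cancel_left₀ (Real.sqrt_pos.2 (hμ i)).ne']
  have hc : Summable fun i => c i ^ 2 := by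
    simpa only [Real.norm_eq_abs, sq_abs] using he.inner_products_summable (x := g)
  have hcG : ∑' i, c i ^ 2 ≤ ‖g‖ ^ 2 := by
    simpa only [Real.norm_eq_abs, sq_abs] using he.tsum_inner_products_le (x := g)
  have hp0 : 0 < r - 1 / 2 := by linarith
  have hp1 : r - 1 / 2 ≤ 1 := by linarith
  have hdle : ∀ i, |μ i ^ (r - 1 / 2) * c i| ≤ ‖T‖ ^ (r - 1 / 2) * |c i| := fun i => by
    rw [abs_mul, abs_of_nonneg (Real.rpow_nonneg (hμ i).le _)]
    gcongr
    · exact (hμ i).le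
    · exact hμT i
  have hd2 := summable_sq_of_abs_le hc hdle
  obtain ⟨h, hh⟩ := hb.summable_smul_of_sq hd2
  have hJh : J h = f := by
    rw [← sub_eq_zero]
    -- As `J†` is injective, it suffices to test `J† (J h - f)` against the complete system.
    -- Eigenvectors with eigenvalue `0` lie in `ker J` and contribute nothing.
    refine hinj _ (hcompl _ fun i => ?_)
    rw [adjoint_inner_right, inner_sub_right]
    by_cases hi : 0 < μ₀ i
    · rw [hfg (μ₀ i) (b₀ i) (hTb₀ i), ← hTinner, hTb₀, real_inner_smul_left,
        hb.inner_eq_of_hasSum hh ⟨i, hi⟩, hJg ⟨i, hi⟩]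
      have h1 : μ₀ i ^ r * √(μ₀ i) = μ₀ i * μ₀ i ^ (r - 1 / 2) := by
        rw [Real.sqrt_eq_rpow, ← Real.rpow_add hi, ← Real.rpow_one_add' hi.le (by linarith)]
        congr 1; ring
      change μ₀ i * (μ₀ i ^ (r - 1 / 2) * c ⟨i, hi⟩) - μ₀ i ^ r * (√(μ₀ i) * c ⟨i, hi⟩) = 0
      linear_combination (-c ⟨i, hi⟩) * h1
    · have h0 : J (b₀ i) = 0 := by
        have := hμ₀ i
        rw [← norm_eq_zero, ← sq_eq_zero_iff]
        exact le_antisymm (by linarith) (sq_nonneg _)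
      simp [h0]
  refine ⟨h, hJh, fun w hw => ?_, ?_⟩
  · rw [real_inner_comm]
    refine ((innerSL ℝ w).hasSum hh).unique ?_
    convert hasSum_zero using 2 with i
    have h1 : μ i * inner ℝ (b i) w = 0 := by
      rw [← real_inner_smul_left, ← hTb, hTinner, hw, inner_zero_right]
    have h2 : inner ℝ w (b i) = 0 := by
      rw [real_inner_comm]; exact (mul_eq_zero.1 h1).resolve_left (hμ i).ne'
    simp [h2]
  have hF : ∀ l : ℝ, ∃ x : H, 0 < l →
      HasSum (fun i => (μ i / (μ i + l) * (μ i ^ (r - 1 / 2) * c i)) • b i) x := fun l => by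
    by_cases hl : 0 < l
    · have hs := summable_sq_of_abs_le (C := 1) hd2
        (d := fun i => μ i / (μ i + l) * (μ i ^ (r - 1 / 2) * c i)) fun i => by
          rw [abs_mul]
          have := hμ i
          gcongr
          rw [abs_of_nonneg (by positivity), div_le_one (by positivity)]
          linarith
      obtain ⟨x, hx⟩ := hb.summable_smul_of_sq hs
      exact ⟨x, fun _ => hx⟩
    · exact ⟨0, fun h => absurd h hl⟩
  choose F hF using hF
  refine ⟨F, fun l hl => ⟨?_, ?_, fun m hlm => ?_⟩⟩
  · have h1 := (T.hasSum (hF l hl)).add ((hF l hl).const_smul l)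
    have h2 := T.hasSum hh
    rw [← hJh]
    change T (F l) + l • F l = T h
    refine h1.unique ?_
    convert h2 using 2 with i
    have := hμ i
    simp only [map_smul, hTb, smul_smul, ← add_smul]
    congr 1
    field_simp
  · have h1 := (hF l hl).sub hh
    simp only [← sub_smul] at h1
    refine hb.norm_le_of_hasSum (by positivity) (norm_nonneg g) hc hcG (fun i => ?_) h1
    have hi := hμ i
    have h2 : μ i / (μ i + l) * (μ i ^ (r - 1 / 2) * c i) - μ i ^ (r - 1 / 2) * c i
        = -(μ i ^ (r - 1 / 2) * l / (μ i + l)) * c i := by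
      field_simp; ring
    rw [h2, abs_mul, abs_neg, abs_of_nonneg (by positivity)]
    gcongr
    rw [div_le_iff₀ (by positivity)]
    have h3 := rpow_mul_rpow_one_sub_le_add hi.le hl.le hp0.le hp1
    have h4 : l ^ (r - 1 / 2) * l ^ (1 - (r - 1 / 2)) = l := by
      rw [← Real.rpow_add hl]; simp
    calc μ i ^ (r - 1 / 2) * l
        = l ^ (r - 1 / 2) * (μ i ^ (r - 1 / 2) * l ^ (1 - (r - 1 / 2))) := by
          rw [mul_left_comm, h4]
      _ ≤ _ := by gcongr
  · have hm : 0 < m := hl.trans_le hlm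
    have h1 := (hF l hl).sub (hF m hm)
    simp only [← sub_smul] at h1
    refine hb.norm_le_of_hasSum (mul_nonneg (by linarith) (by positivity)) (norm_nonneg g) hc hcG
      (fun i => ?_) h1
    have hi := hμ i
    have h2 : μ i / (μ i + l) * (μ i ^ (r - 1 / 2) * c i)
          - μ i / (μ i + m) * (μ i ^ (r - 1 / 2) * c i)
        = ((m - l) * (μ i / (μ i + l) * (μ i ^ (r - 1 / 2) / (μ i + m)))) * c i := by
      field_simp; ring
    have hml : 0 ≤ m - l := by linarith
    rw [h2, abs_mul, abs_of_nonneg (by positivity)]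
    gcongr
    have h5 : μ i / (μ i + l) ≤ 1 := by
      rw [div_le_one (by positivity)]; linarith
    have h6 : μ i ^ (r - 1 / 2) / (μ i + m) ≤ m ^ (r - 3 / 2) := by
      rw [div_le_iff₀ (by positivity)]
      have h3 := rpow_mul_rpow_one_sub_le_add hi.le hm.le hp0.le hp1
      have h4 : m ^ (r - 3 / 2) * m ^ (1 - (r - 1 / 2)) = 1 := by
        rw [← Real.rpow_add hm]; ring_nf; simp
      calc μ i ^ (r - 1 / 2)
          = m ^ (r - 3 / 2) * (μ i ^ (r - 1 / 2) * m ^ (1 - (r - 1 / 2))) := by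
            rw [mul_left_comm, h4, mul_one]
        _ ≤ _ := by gcongr
    calc _ ≤ 1 * m ^ (r - 3 / 2) := by gcongr
      _ = _ := one_mul _

end Spectral

/-! ### The sampling operator -/

section Sampling

variable {H : Type*} [NormedAddCommGroup H] [InnerProductSpace ℝ H]
  {X : Type*} [MeasurableSpace X] {ν : Measure X} {k : X → H} {κ : ℝ}

lemma memLp_two_of_forall_norm_le [IsFiniteMeasure ν] (hk : StronglyMeasurable k)
    (hκ : ∀ x, ‖k x‖ ≤ κ) (f : H) : MemLp (fun x => inner ℝ (k x) f) 2 ν :=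
  MemLp.of_bound (hk.inner stronglyMeasurable_const).aestronglyMeasurable (κ * ‖f‖)
    (Eventually.of_forall fun x => (norm_inner_le_norm _ _).trans
      (mul_le_mul_of_nonneg_right (hκ x) (norm_nonneg f)))

/-- The operator `f ↦ ⟪k ·, f⟫` from `H` to `L²(ν)`. -/
noncomputable def samplingOp [IsProbabilityMeasure ν] (hk : StronglyMeasurable k)
    (hκ : ∀ x, ‖k x‖ ≤ κ) : H →L[ℝ] Lp ℝ 2 ν :=
  LinearMap.mkContinuous
    { toFun := fun f => (memLp_two_of_forall_norm_le hk hκ f).toLp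
      map_add' := fun f g => by
        rw [← MemLp.toLp_add]
        exact MemLp.toLp_congr _ _ (Eventually.of_forall fun x => inner_add_right _ _ _)
      map_smul' := fun c f => by
        rw [RingHom.id_apply, ← MemLp.toLp_const_smul]
        exact MemLp.toLp_congr _ _ (Eventually.of_forall fun x => real_inner_smul_right _ _ _) }
    κ fun f => by
      have hκ0 : 0 ≤ κ := by
        obtain ⟨x⟩ : Nonempty X := nonempty_of_isProbabilityMeasure ν
        exact (norm_nonneg _).trans (hκ x)
      have := Lp.norm_le_of_ae_bound (f := (memLp_two_of_forall_norm_le (ν := ν) hk hκ f).toLp)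
        (C := κ * ‖f‖) (by positivity) (by
          filter_upwards [(memLp_two_of_forall_norm_le (ν := ν) hk hκ f).coeFn_toLp] with x hx
          rw [hx]
          exact (norm_inner_le_norm _ _).trans (mul_le_mul_of_nonneg_right (hκ x) (norm_nonneg f)))
      simpa [measureUnivNNReal] using this

variable [IsProbabilityMeasure ν] (hk : StronglyMeasurable k) (hκ : ∀ x, ‖k x‖ ≤ κ)

lemma coeFn_samplingOp (f : H) : samplingOp (ν := ν) hk hκ f =ᵐ[ν] fun x => inner ℝ (k x) f :=
  (memLp_two_of_forall_norm_le hk hκ f).coeFn_toLp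

lemma inner_samplingOp (f : H) (v : Lp ℝ 2 ν) :
    inner ℝ (samplingOp hk hκ f) v = ∫ x, inner ℝ (k x) f * v x ∂ν := by
  rw [L2.inner_def]
  refine integral_congr_ae ?_
  filter_upwards [coeFn_samplingOp (ν := ν) hk hκ f] with x hx
  rw [hx, real_inner_eq_re_inner]
  simp [mul_comm]

variable [CompleteSpace H]

open ContinuousLinearMap in
lemma inner_adjoint_samplingOp (f : H) {v : Lp ℝ 2 ν} {u : X → ℝ} (hu : v =ᵐ[ν] u) :
    inner ℝ f (adjoint (samplingOp hk hκ) v) = ∫ x, inner ℝ (k x) f * u x ∂ν := by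
  rw [adjoint_inner_right, inner_samplingOp]
  refine integral_congr_ae ?_
  filter_upwards [hu] with x hx
  rw [hx]

open ContinuousLinearMap InnerProductSpace in
/-- The covariance operator of a bounded random vector is compact. -/
lemma isCompactOperator_adjoint_comp_samplingOp :
    IsCompactOperator (adjoint (samplingOp (ν := ν) hk hκ) ∘L samplingOp hk hκ) := by
  have hm : StronglyMeasurable fun x => rankOne ℝ (k x) (k x) :=
    (show Continuous fun v : H => rankOne ℝ v v from
      ((rankOne ℝ).continuous.comp continuous_id).clm_apply continuous_id).comp_stronglyMeasurable hk
  have hint : Integrable (fun x => rankOne ℝ (k x) (k x)) ν :=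
    Integrable.of_bound hm.aestronglyMeasurable (κ * κ) (Eventually.of_forall fun x => by
      rw [norm_rankOne]
      exact mul_le_mul (hκ x) (hκ x) (norm_nonneg _) ((norm_nonneg _).trans (hκ x)))
  have heq : adjoint (samplingOp (ν := ν) hk hκ) ∘L samplingOp hk hκ
      = ∫ x, rankOne ℝ (k x) (k x) ∂ν := by
    ext f
    refine ext_inner_left ℝ fun w => ?_
    rw [comp_apply, inner_adjoint_samplingOp hk hκ w (coeFn_samplingOp hk hκ f),
      integral_apply hint, ← integral_inner (hint.apply_continuousLinearMap f)]
    refine integral_congr_ae (Eventually.of_forall fun x => ?_)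
    simp only [rankOne_apply, real_inner_smul_right]
    rw [real_inner_comm w, mul_comm]
  rw [heq]
  -- The covariance operator is a mean, in operator norm, of rank one operators, and the compact
  -- operators form a closed convex set.
  refine Convex.integral_mem (s := {A : H →L[ℝ] H | IsCompactOperator A})
    (compactOperator (RingHom.id ℝ) H H).convex isClosed_setOfPred_isCompactOperator
    (Eventually.of_forall fun x => ?_) hint
  change IsCompactOperator (rankOne ℝ (k x) (k x))
  rw [rankOne_def']
  exact (isCompactOperator_of_locallyCompactSpace_rng
    (toSpanSingleton ℝ (k x))).comp_clm (innerSL ℝ (k x))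

end Sampling

lemma l2norm_eq_norm_toLp {X : Type*} [MeasurableSpace X] {ν : Measure X} {g : X → ℝ}
    (hg : MemLp g 2 ν) : l2norm ν g = ‖hg.toLp‖ := by
  rw [l2norm, Real.sqrt_eq_iff_mul_self_eq (integral_nonneg fun x => by positivity)
    (norm_nonneg _), ← pow_two, ← real_inner_self_eq_norm_sq, L2.inner_def]
  refine integral_congr_ae ?_
  filter_upwards [hg.coeFn_toLp] with x hx
  rw [hx, real_inner_self_eq_norm_sq, Real.norm_eq_abs]

/-! ### The reproducing kernel Hilbert space and its regularization path -/

namespace MercerKernel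

variable {X : Type*} [TopologicalSpace X] (K : MercerKernel X)

lemma inner_kerAt_left (x : X) (f : K.HK) : inner ℝ (K.kerAt x) f = f x := by
  rw [kerAt, RKHS.kerFun_inner]
  simp

lemma inner_kerAt_kerAt (x x' : X) : inner ℝ (K.kerAt x) (K.kerAt x') = K x x' := by
  rw [inner_kerAt_left, kerAt_apply, K.symm]

lemma norm_kerAt (x : X) : ‖K.kerAt x‖ = √(K x x) := by
  rw [← inner_kerAt_kerAt, real_inner_self_eq_norm_sq, Real.sqrt_sq (norm_nonneg _)]

lemma continuous_kerAt : Continuous K.kerAt := by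
  rw [continuous_iff_continuousAt]
  intro x₀
  rw [ContinuousAt, tendsto_iff_norm_sub_tendsto_zero]
  have h : ∀ x, ‖K.kerAt x - K.kerAt x₀‖ = √(K x x - 2 * K x x₀ + K x₀ x₀) := fun x => by
    rw [← inner_kerAt_kerAt, ← inner_kerAt_kerAt, ← inner_kerAt_kerAt, real_inner_self_eq_norm_sq,
      real_inner_self_eq_norm_sq, ← norm_sub_sq_real, Real.sqrt_sq (norm_nonneg _)]
  simp_rw [h]
  have hK := K.continuous_toFun
  have hc : Continuous fun x => √(K x x - 2 * K x x₀ + K x₀ x₀) := by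
    have h1 : Continuous fun x => K x x := hK.comp (continuous_id.prodMk continuous_id)
    have h2 : Continuous fun x => K x x₀ := hK.comp (continuous_id.prodMk continuous_const)
    fun_prop
  have := hc.tendsto x₀
  rwa [show K x₀ x₀ - 2 * K x₀ x₀ + K x₀ x₀ = 0 by ring, Real.sqrt_zero] at this

/-- Separability makes `H_K` second countable, as the joint measurability of the recursion requires.
-/
lemma separableSpace_HK [SecondCountableTopology X] : TopologicalSpace.SeparableSpace K.HK := by
  have h1 : TopologicalSpace.IsSeparable (Set.range K.kerAt) :=
    TopologicalSpace.isSeparable_range K.continuous_kerAt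
  have h2 := (h1.span (R := ℝ)).closure
  have h3 := RKHS.kerFun_dense K.HK
  have h4 : Submodule.span ℝ {RKHS.kerFun K.HK x v | (x) (v)}
      ≤ Submodule.span ℝ (Set.range K.kerAt) := by
    rw [Submodule.span_le]
    rintro _ ⟨x, v, rfl⟩
    have : RKHS.kerFun K.HK x v = v • K.kerAt x := by
      rw [kerAt, ← map_smul, smul_eq_mul, mul_one]
    rw [this]
    exact Submodule.smul_mem _ _ (Submodule.subset_span ⟨x, rfl⟩)
  rw [← TopologicalSpace.isSeparable_univ_iff]
  refine h2.mono fun f _ => ?_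
  have h5 : f ∈ (Submodule.span ℝ {RKHS.kerFun K.HK x v | (x) (v)}).topologicalClosure := by
    rw [h3]; trivial
  exact closure_mono h4 h5

lemma norm_kerAt_le_kappa (hκ : BddAbove (Set.range fun x : X => √(K x x))) (x : X) :
    ‖K.kerAt x‖ ≤ K.kappa := by
  rw [norm_kerAt]
  exact le_ciSup hκ x

section RegularizationPath

variable {K} [SecondCountableTopology X] [MeasurableSpace X] [BorelSpace X] {ν : Measure X}
  [IsProbabilityMeasure ν]

open ContinuousLinearMap in
/-- Under a source condition with exponent `r ∈ (1/2, 3/2]`, the target has a unique version in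
`H_K`, and the Tikhonov regularization path converges to it. -/
lemma exists_version_and_path (hκ : BddAbove (Set.range fun x : X => √(K x x)))
    (hpos : K.EigenvaluesPos ν) {r : ℝ} (hr : r ∈ Set.Ioc (1 / 2 : ℝ) (3 / 2)) {g f : X → ℝ}
    (hg : K.IsRpow ν r g f) :
    ∃ h : K.HK, K.IsVersion ν f h ∧ (∀ h', K.IsVersion ν f h' → h' = h) ∧
      ∃ F : ℝ → K.HK, ∀ l, 0 < l →
        (∀ w : K.HK, ∫ x, F l x * w x ∂ν + l * inner ℝ (F l) w = ∫ x, f x * w x ∂ν) ∧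
        ‖F l - h‖ ≤ l ^ (r - 1 / 2) * l2norm ν g ∧
        ∀ m, l ≤ m → ‖F l - F m‖ ≤ (m - l) * m ^ (r - 3 / 2) * l2norm ν g := by
  have hk : StronglyMeasurable K.kerAt := K.continuous_kerAt.stronglyMeasurable
  have hkκ := K.norm_kerAt_le_kappa hκ
  set J : K.HK →L[ℝ] Lp ℝ 2 ν := samplingOp hk hkκ with hJdef
  have hJ : ∀ w : K.HK, J w =ᵐ[ν] fun x => w x := fun w => by
    simpa only [inner_kerAt_left] using coeFn_samplingOp (ν := ν) hk hkκ w
  have hadj : ∀ (w : K.HK) {v : Lp ℝ 2 ν} {u : X → ℝ}, v =ᵐ[ν] u →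
      inner ℝ w (adjoint J v) = ∫ x, w x * u x ∂ν := fun w v u hu => by
    simpa only [inner_kerAt_left] using inner_adjoint_samplingOp hk hkκ w hu
  have hop : ∀ {v : Lp ℝ 2 ν} {u : X → ℝ}, v =ᵐ[ν] u → ∀ x,
      K.integralOp ν u x = (adjoint J v) x := fun {v u} hu x => by
    rw [← inner_kerAt_left, hadj _ hu, integralOp]
    simp only [kerAt_apply]
  -- A nonzero `v` with `J† v = 0` would be an eigenfunction of `L_K` for the eigenvalue `0`.
  have hinj : ∀ v, adjoint J v = 0 → v = 0 := fun v hv => by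
    by_contra hne
    refine lt_irrefl (0 : ℝ) (hpos 0 v ⟨Lp.memLp v, Eventually.of_forall fun x => ?_⟩
      fun h0 => hne ((Lp.eq_zero_iff_ae_eq_zero).2 h0))
    rw [hop (EventuallyEq.refl _ _), hv, zero_mul]
    simp
  have hfg : ∀ (μ : ℝ) (b : K.HK), adjoint J (J b) = μ • b →
      inner ℝ (J b) hg.memLp_right.toLp = μ ^ r * inner ℝ (J b) hg.memLp_left.toLp := by
    intro μ b hb
    have he : K.IsEigenpair ν μ b := by
      refine ⟨(memLp_congr_ae (hJ b)).1 (Lp.memLp _), Eventually.of_forall fun x => ?_⟩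
      rw [hop (hJ b), hb]
      simp
    rw [← adjoint_inner_right, ← adjoint_inner_right, hadj b hg.memLp_right.coeFn_toLp,
      hadj b hg.memLp_left.coeFn_toLp]
    exact hg.coeff_eq μ b he
  have hver : ∀ w : K.HK, (∀ᵐ x ∂ν, w x = f x) ↔ J w = hg.memLp_right.toLp := fun w => by
    rw [Lp.ext_iff]
    constructor
    · intro h
      filter_upwards [h, hJ w, hg.memLp_right.coeFn_toLp] with x h1 h2 h3
      rw [h2, h3, h1]
    · intro h
      filter_upwards [h, hJ w, hg.memLp_right.coeFn_toLp] with x h1 h2 h3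
      rw [← h2, h1, h3]
  obtain ⟨h, hJh, horth, F, hF⟩ := exists_regularization_path
    (isCompactOperator_adjoint_comp_samplingOp hk hkκ) hinj hr.1 hr.2 hfg
  -- Any other version differs from `h` by an element of `ker J`, to which `h` is orthogonal. This
  -- gives both minimality of the norm and uniqueness.
  have hpyth : ∀ h' : K.HK, (∀ᵐ x ∂ν, h' x = f x) → ‖h'‖ ^ 2 = ‖h‖ ^ 2 + ‖h' - h‖ ^ 2 := by
    intro h' hh'
    have h0 : inner ℝ h (h' - h) = 0 := horth _ (by rw [map_sub, (hver h').1 hh', hJh, sub_self])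
    have := norm_add_sq_real h (h' - h)
    rw [add_sub_cancel, h0] at this
    linarith
  refine ⟨h, ⟨(hver h).2 hJh, fun h' hh' => ?_⟩, fun h' hh' => ?_, F, fun l hl => ⟨fun w => ?_, ?_⟩⟩
  · have := hpyth h' hh'
    exact le_of_sq_le_sq (by nlinarith [sq_nonneg ‖h' - h‖]) (norm_nonneg _)
  · have h1 := hpyth h' hh'.1
    have h2 := hh'.2 h ((hver h).2 hJh)
    have h3 : ‖h' - h‖ ^ 2 ≤ 0 := by nlinarith [norm_nonneg h', norm_nonneg h]
    rw [← sub_eq_zero, ← norm_eq_zero, ← sq_eq_zero_iff]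
    exact le_antisymm h3 (sq_nonneg _)
  · have h1 := congrArg (inner ℝ w) (hF l hl).1
    rw [inner_add_right, inner_smul_right, hadj w (hJ _), hadj w hg.memLp_right.coeFn_toLp] at h1
    rw [real_inner_comm]
    simpa only [mul_comm (w _)] using h1
  · rw [l2norm_eq_norm_toLp hg.memLp_left]
    exact (hF l hl).2

end RegularizationPath

end MercerKernel

/-! ### Step sizes and regularization parameters -/

section Rates

variable {r a x : ℝ}

/-- The step size is `a` times the target rate times `x ^ (-1/2)`; the last factor tames the size of
the noise and supplies the `1 / x` in its variance. -/
lemma one_div_rpow_two_mul_div (hr : 1 / 2 < r) (hx : 0 < x) :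
    (1 / x) ^ (2 * r / (2 * r + 1)) = (1 / x) ^ ((2 * r - 1) / (4 * r + 2)) * √(1 / x) := by
  rw [Real.sqrt_eq_rpow, ← Real.rpow_add (by positivity)]
  congr 1
  field_simp
  ring

lemma step_mul_reg (hr : 1 / 2 < r) (ha : 1 ≤ a) (hx : 0 < x) :
    a * (1 / x) ^ (2 * r / (2 * r + 1)) * (1 / a * (1 / x) ^ (1 / (2 * r + 1))) = 1 / x := by
  have h1 : (1 / x) ^ (2 * r / (2 * r + 1)) * (1 / x) ^ (1 / (2 * r + 1)) = 1 / x := by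
    rw [← Real.rpow_add (by positivity), ← add_div, div_self (by linarith), Real.rpow_one]
  field_simp at h1 ⊢
  linarith

lemma step_mul_le {κ : ℝ} (hr : 1 / 2 < r) (hx : 1 ≤ x)
    (hxκ : a * κ ^ 2 + 1 ≤ x ^ (2 * r / (2 * r + 1))) :
    a * (1 / x) ^ (2 * r / (2 * r + 1)) * κ ^ 2 ≤ 1 - 1 / x := by
  have hx0 : 0 < x := by linarith
  have h1 : 1 / x ≤ (1 / x) ^ (2 * r / (2 * r + 1)) := by
    nth_rw 1 [← Real.rpow_one (1 / x)]
    refine Real.rpow_le_rpow_of_exponent_ge (by positivity) ((div_le_one hx0).2 hx) ?_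
    rw [div_le_one (by linarith)]; linarith
  have h2 : (1 / x) ^ (2 * r / (2 * r + 1)) * x ^ (2 * r / (2 * r + 1)) = 1 := by
    rw [← Real.mul_rpow (by positivity) hx0.le, one_div_mul_cancel hx0.ne', Real.one_rpow]
  have h3 := mul_le_mul_of_nonneg_left hxκ
    (show 0 ≤ (1 / x) ^ (2 * r / (2 * r + 1)) by positivity)
  linarith

lemma reg_le_one (hr : 1 / 2 < r) (ha : 1 ≤ a) (hx : 1 ≤ x) :
    1 / a * (1 / x) ^ (1 / (2 * r + 1)) ≤ 1 := by
  have hx0 : 0 < x := by linarith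
  exact mul_le_one₀ ((div_le_one (by linarith)).2 ha) (by positivity)
    (Real.rpow_le_one (by positivity) ((div_le_one hx0).2 hx) (by positivity))

lemma sq_le_mul_reg {κ : ℝ} (hr : 1 / 2 < r) (ha : 1 ≤ a) (hx : 0 < x)
    (hxκ : a * κ ^ 2 + 1 ≤ x ^ (2 * r / (2 * r + 1))) :
    κ ^ 2 ≤ x * (1 / a * (1 / x) ^ (1 / (2 * r + 1))) := by
  have h : x * (1 / x) ^ (1 / (2 * r + 1)) = x ^ (2 * r / (2 * r + 1)) := by
    rw [one_div x, Real.inv_rpow hx.le, ← Real.rpow_neg hx.le, ← Real.rpow_one_add' hx.le]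
    · congr 1; field_simp; ring
    · have : 1 / (2 * r + 1) < 1 := by rw [div_lt_one (by linarith)]; linarith
      linarith
  have ha0 : 0 < a := by linarith
  rw [mul_left_comm, h, one_div, le_inv_mul_iff₀ ha0]
  linarith

lemma reg_rpow (hr : 1 / 2 < r) (ha : 1 ≤ a) (hx : 0 < x) :
    (1 / a * (1 / x) ^ (1 / (2 * r + 1))) ^ (r - 1 / 2)
      = a ^ (1 / 2 - r) * (1 / x) ^ ((2 * r - 1) / (4 * r + 2)) := by
  have ha0 : 0 < a := by linarith
  rw [Real.mul_rpow (by positivity) (by positivity), ← Real.rpow_mul (by positivity)]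
  congr 1
  · rw [one_div, Real.inv_rpow ha0.le, ← Real.rpow_neg ha0.le]; congr 1; ring
  · congr 1
    field_simp
    ring

lemma one_div_rpow_sub_le {τ : ℝ} (hτ1 : τ ≤ 1) (hx : 0 < x) :
    (1 / x) ^ τ - (1 / (x + 1)) ^ τ ≤ (1 / x) ^ τ / (x + 1) := by
  have h1 : (1 / (x + 1)) ^ τ = (1 / x) ^ τ * (x / (x + 1)) ^ τ := by
    rw [← Real.mul_rpow (by positivity) (by positivity)]
    congr 1; field_simp
  have h2 : x / (x + 1) ≤ (x / (x + 1)) ^ τ := by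
    nth_rw 1 [← Real.rpow_one (x / (x + 1))]
    refine Real.rpow_le_rpow_of_exponent_ge (by positivity) ?_ hτ1
    rw [div_le_one (by positivity)]; linarith
  have h3 : x / (x + 1) = 1 - 1 / (x + 1) := by field_simp; ring
  have h4 : 0 ≤ (1 / x) ^ τ := by positivity
  rw [h1, div_eq_mul_one_div ((1 / x) ^ τ)]
  nlinarith [mul_le_mul_of_nonneg_left h2 h4]

lemma mul_one_div_rpow {s : ℝ} (hs : s < 1) (hx : 0 < x) : x * (1 / x) ^ s = x ^ (1 - s) := by
  rw [one_div, Real.inv_rpow hx.le, ← Real.rpow_neg hx.le, ← Real.rpow_one_add' hx.le (by linarith)]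
  rfl

lemma mul_one_div_rpow_mono {s : ℝ} (hs : s < 1) (hx : 0 < x) :
    x * (1 / x) ^ s ≤ (x + 1) * (1 / (x + 1)) ^ s := by
  rw [mul_one_div_rpow hs hx, mul_one_div_rpow hs (by linarith)]
  exact Real.rpow_le_rpow hx.le (by linarith) (by linarith)

/-- The squared rate is a supersolution of the variance recursion: since `2 s < 1`, the function `x
^ (1 - 2 s)` increases, so `x` copies of its value at `x` plus one at `x + 1` are at most `x + 1`
copies of the latter. -/
lemma sq_one_div_rpow_step {s : ℝ} (hs : s < 1 / 2) (hx : 0 < x) :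
    (x / (x + 1)) ^ 2 * ((1 / x) ^ s) ^ 2 + ((1 / (x + 1)) ^ s) ^ 2 / (x + 1)
      ≤ ((1 / (x + 1)) ^ s) ^ 2 := by
  have h := mul_one_div_rpow_mono (s := s + s) (by linarith) hx
  rw [Real.rpow_add (by positivity), Real.rpow_add (by positivity), ← sq, ← sq] at h
  have hx1 : 0 < x + 1 := by linarith
  have h2 : (x / (x + 1)) ^ 2 * ((1 / x) ^ s) ^ 2 + ((1 / (x + 1)) ^ s) ^ 2 / (x + 1)
      = (x * (x * ((1 / x) ^ s) ^ 2) + (x + 1) * ((1 / (x + 1)) ^ s) ^ 2) / (x + 1) ^ 2 := by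
    field_simp
  rw [h2, div_le_iff₀ (by positivity)]
  nlinarith [mul_le_mul_of_nonneg_left h hx.le]

/-- The rate times `C` is a supersolution of the drift recursion. Bernoulli's inequality for the
concave power `1 - s` yields a gain `(1 - s) / (x + 1)` per step, which pays for the drift as soon
as `C ≥ 1 / (1 - s)`. -/
lemma drift_step {s C : ℝ} (hs0 : 0 ≤ s) (hs : s < 1) (hC : 1 ≤ C * (1 - s)) (hx : 0 < x) :
    x * (1 / x) ^ s * (C + 1 / (x + 1)) ≤ C * ((x + 1) * (1 / (x + 1)) ^ s) := by
  have hx1 : 0 < x + 1 := by linarith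
  have hmono := mul_one_div_rpow_mono hs hx
  have hC0 : 0 < C := pos_of_mul_pos_left (by linarith) (by linarith : (0 : ℝ) ≤ 1 - s)
  rw [mul_one_div_rpow hs hx, mul_one_div_rpow hs hx1] at hmono ⊢
  have h1 : x ^ (1 - s) = (x + 1) ^ (1 - s) * (1 + -(1 / (x + 1))) ^ (1 - s) := by
    rw [← Real.mul_rpow hx1.le]
    · congr 1; field_simp; ring
    · have : 1 / (x + 1) ≤ 1 := by rw [div_le_one hx1]; linarith
      linarith
  have h2 : (1 + -(1 / (x + 1))) ^ (1 - s) ≤ 1 + (1 - s) * -(1 / (x + 1)) :=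
    rpow_one_add_le_one_add_mul_self
      (by have : 1 / (x + 1) ≤ 1 := by rw [div_le_one hx1]; linarith
          linarith) (by linarith) (by linarith)
  have h3 : 0 < (x + 1) ^ (1 - s) := by positivity
  have h4 : 0 < 1 / (x + 1) := by positivity
  have h5 : x ^ (1 - s) ≤ (x + 1) ^ (1 - s) * (1 + (1 - s) * -(1 / (x + 1))) := by
    rw [h1]; gcongr
  nlinarith [mul_le_mul_of_nonneg_left h5 hC0.le, mul_le_mul_of_nonneg_right hmono h4.le,
    mul_le_mul_of_nonneg_right hC (mul_pos h3 h4).le]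

end Rates

/-! ### Stochastic approximation of the regularization path -/

section Noise

variable {H : Type*} [NormedAddCommGroup H] [InnerProductSpace ℝ H]

open InnerProductSpace in
/-- The linear part `w ↦ w - γ (⟪v, w⟫ v + l w)` of a step of the online algorithm. -/
noncomputable def onlineStep (γ l : ℝ) (v : H) : H →L[ℝ] H :=
  ContinuousLinearMap.id ℝ H - γ • (rankOne ℝ v v + l • ContinuousLinearMap.id ℝ H)

lemma onlineStep_apply (γ l : ℝ) (v w : H) :
    onlineStep γ l v w = w - γ • (inner ℝ v w • v + l • w) := by
  simp [onlineStep]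

/-- The operator is `(1 - γ l) I - γ v ⊗ v`. Its rank one part only shrinks `(1 - γ l) w` as long as
it does not overshoot, which the hypothesis on `γ * ‖v‖ ^ 2` ensures. -/
lemma norm_onlineStep_le {γ l : ℝ} {v : H} (hγ : 0 ≤ γ) (h : γ * ‖v‖ ^ 2 ≤ 1 - γ * l) :
    ‖onlineStep γ l v‖ ≤ 1 - γ * l := by
  have h0 : 0 ≤ 1 - γ * l := le_trans (by positivity) h
  refine ContinuousLinearMap.opNorm_le_bound _ h0 fun w => ?_
  refine le_of_sq_le_sq ?_ (by positivity)
  have h1 : onlineStep γ l v w = (1 - γ * l) • w - (γ * inner ℝ v w) • v := by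
    rw [onlineStep_apply]; module
  rw [h1, norm_sub_sq_real, norm_smul, norm_smul, real_inner_smul_left, real_inner_smul_right,
    real_inner_comm v w, mul_pow, mul_pow, mul_pow, Real.norm_eq_abs, Real.norm_eq_abs, sq_abs, sq_abs]
  have h2 : 0 ≤ γ * (inner ℝ v w) ^ 2 := by positivity
  nlinarith [mul_le_mul_of_nonneg_left h h2, mul_nonneg h2 h0]

variable {Z : Type*} [MeasurableSpace Z] {ρ : Measure Z} [IsProbabilityMeasure ρ]
  {k : Z → H} {y : Z → ℝ} {κ M : ℝ}

/-- The bounds for the Tikhonov regularized solution `F` with parameter `l` and for the noise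
`(y - ⟪k, F⟫) k - l F`. -/
lemma tikhonov_noise_bounds [CompleteSpace H] (hk : StronglyMeasurable k) (hκ : ∀ u, ‖k u‖ ≤ κ)
    (hy : Measurable y) (hM : ∀ᵐ u ∂ρ, |y u| ≤ M) {F : H} {l : ℝ} (hl : 0 ≤ l)
    (hF : ∀ w, ∫ u, (y u - inner ℝ (k u) F) * inner ℝ (k u) w ∂ρ = l * inner ℝ F w) :
    l * ‖F‖ ^ 2 ≤ M ^ 2 / 4 ∧
    (∀ᵐ u ∂ρ, ‖(y u - inner ℝ (k u) F) • k u - l • F‖ ≤ κ * (M + κ * ‖F‖) + l * ‖F‖) ∧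
    ∫ u, ((y u - inner ℝ (k u) F) • k u - l • F) ∂ρ = 0 ∧
    ∫ u, ‖(y u - inner ℝ (k u) F) • k u - l • F‖ ^ 2 ∂ρ ≤ κ ^ 2 * M ^ 2 := by
  obtain ⟨u₀⟩ : Nonempty Z := nonempty_of_isProbabilityMeasure ρ
  have hκ0 : 0 ≤ κ := (norm_nonneg _).trans (hκ u₀)
  have hM0 : 0 ≤ M := by
    obtain ⟨u, hu⟩ := hM.exists
    exact (abs_nonneg _).trans hu
  have hkm : ∀ w, StronglyMeasurable fun u => inner ℝ (k u) w := fun w =>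
    hk.inner stronglyMeasurable_const
  have hkb : ∀ w u, |inner ℝ (k u) w| ≤ κ * ‖w‖ := fun w u =>
    (abs_real_inner_le_norm _ _).trans (mul_le_mul_of_nonneg_right (hκ u) (norm_nonneg w))
  have hem : StronglyMeasurable fun u => y u - inner ℝ (k u) F :=
    hy.stronglyMeasurable.sub (hkm F)
  have heb : ∀ᵐ u ∂ρ, |y u - inner ℝ (k u) F| ≤ M + κ * ‖F‖ := by
    filter_upwards [hM] with u hu
    exact (abs_sub _ _).trans (add_le_add hu (hkb F u))
  have hζm : StronglyMeasurable fun u => (y u - inner ℝ (k u) F) • k u := hem.smul hk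
  have hζb : ∀ᵐ u ∂ρ, ‖(y u - inner ℝ (k u) F) • k u‖ ≤ κ * (M + κ * ‖F‖) := by
    filter_upwards [heb] with u hu
    rw [norm_smul, mul_comm κ]
    exact mul_le_mul hu (hκ u) (norm_nonneg _) ((abs_nonneg _).trans hu)
  have hζ : Integrable (fun u => (y u - inner ℝ (k u) F) • k u) ρ :=
    Integrable.of_bound hζm.aestronglyMeasurable _ hζb
  have hmean : ∫ u, (y u - inner ℝ (k u) F) • k u ∂ρ = l • F := by
    refine ext_inner_left ℝ fun w => ?_
    rw [← integral_inner hζ, real_inner_smul_right, real_inner_comm, ← hF w]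
    refine integral_congr_ae (Eventually.of_forall fun u => ?_)
    simp only
    rw [real_inner_smul_right, real_inner_comm w]
  have heF : Integrable (fun u => (y u - inner ℝ (k u) F) * inner ℝ (k u) F) ρ := by
    refine Integrable.of_bound (hem.mul (hkm F)).aestronglyMeasurable
      ((M + κ * ‖F‖) * (κ * ‖F‖)) ?_
    filter_upwards [heb] with u hu
    rw [norm_mul]
    exact mul_le_mul hu (hkb F u) (norm_nonneg _) ((abs_nonneg _).trans hu)
  have hFF : ∫ u, (y u - inner ℝ (k u) F) * inner ℝ (k u) F ∂ρ = l * ‖F‖ ^ 2 := by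
    rw [hF F, real_inner_self_eq_norm_sq]
  -- Test the normal equation with `F` itself and use `(y - F) F ≤ y ^ 2 / 4` pointwise.
  have hlF : l * ‖F‖ ^ 2 ≤ M ^ 2 / 4 := by
    rw [← hFF]
    calc ∫ u, (y u - inner ℝ (k u) F) * inner ℝ (k u) F ∂ρ ≤ ∫ _, M ^ 2 / 4 ∂ρ := by
          refine integral_mono_ae heF (integrable_const _) ?_
          filter_upwards [hM] with u hu
          have := sq_le_sq' (abs_le.1 hu).1 (abs_le.1 hu).2
          nlinarith [sq_nonneg (y u - 2 * inner ℝ (k u) F)]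
      _ = M ^ 2 / 4 := by simp
  refine ⟨hlF, ?_, ?_, ?_⟩
  · filter_upwards [hζb] with u hu
    refine (norm_sub_le _ _).trans (add_le_add hu ?_)
    rw [norm_smul, Real.norm_of_nonneg hl]
  · rw [integral_sub hζ (integrable_const _), hmean]
    simp
  · have hζ2 : Integrable (fun u => ‖(y u - inner ℝ (k u) F) • k u‖ ^ 2) ρ := by
      refine Integrable.of_bound (hζm.norm.pow 2).aestronglyMeasurable
        ((κ * (M + κ * ‖F‖)) ^ 2) ?_
      filter_upwards [hζb] with u hu
      rw [norm_pow, norm_norm]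
      exact pow_le_pow_left₀ (norm_nonneg _) hu 2
    have hζF : Integrable (fun u => inner ℝ (l • F) ((y u - inner ℝ (k u) F) • k u)) ρ :=
      hζ.const_inner _
    have hvar : ∫ u, ‖(y u - inner ℝ (k u) F) • k u - l • F‖ ^ 2 ∂ρ
        = ∫ u, ‖(y u - inner ℝ (k u) F) • k u‖ ^ 2 ∂ρ - ‖l • F‖ ^ 2 := by
      have hexp : ∀ u, ‖(y u - inner ℝ (k u) F) • k u - l • F‖ ^ 2
          = ‖(y u - inner ℝ (k u) F) • k u‖ ^ 2
            - 2 * inner ℝ (l • F) ((y u - inner ℝ (k u) F) • k u) + ‖l • F‖ ^ 2 := fun u => by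
        rw [norm_sub_sq_real, real_inner_comm (l • F)]
      simp_rw [hexp]
      rw [integral_add (f := fun u => ‖(y u - inner ℝ (k u) F) • k u‖ ^ 2
          - 2 * inner ℝ (l • F) ((y u - inner ℝ (k u) F) • k u)) (hζ2.sub (hζF.const_mul 2))
        (integrable_const _), integral_sub hζ2 (hζF.const_mul 2), integral_const_mul,
        integral_inner hζ, hmean, real_inner_self_eq_norm_sq]
      simp only [integral_const, probReal_univ, smul_eq_mul]
      ring
    rw [hvar]
    calc _ ≤ ∫ u, ‖(y u - inner ℝ (k u) F) • k u‖ ^ 2 ∂ρ := by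
          linarith [sq_nonneg ‖l • F‖]
      -- From `(y - F)² = y² - 2 (y - F) F - F²`. The cross term integrates to `-2 l ‖F‖² ≤ 0`, so
      -- the variance bound does not depend on `l`.
      _ ≤ ∫ u, κ ^ 2 * (M ^ 2 - 2 * ((y u - inner ℝ (k u) F) * inner ℝ (k u) F)) ∂ρ := by
          refine integral_mono_ae hζ2
            (((integrable_const _).sub (heF.const_mul 2)).const_mul _) ?_
          filter_upwards [hM] with u hu
          have h1 := sq_le_sq' (abs_le.1 hu).1 (abs_le.1 hu).2
          have h2 : ‖k u‖ ^ 2 ≤ κ ^ 2 := pow_le_pow_left₀ (norm_nonneg _) (hκ u) 2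
          rw [norm_smul, mul_pow, Real.norm_eq_abs, sq_abs, mul_comm]
          refine mul_le_mul h2 ?_ (sq_nonneg _) (sq_nonneg _)
          nlinarith [sq_nonneg (inner ℝ (k u) F)]
      _ = κ ^ 2 * (M ^ 2 - 2 * (l * ‖F‖ ^ 2)) := by
          rw [integral_const_mul, integral_sub (integrable_const _) (heF.const_mul 2),
            integral_const_mul, hFF]
          simp
      _ ≤ κ ^ 2 * M ^ 2 := by
          gcongr
          have := mul_nonneg hl (sq_nonneg ‖F‖)
          linarith

end Noise

/-! ### Drift and noise of the online algorithm -/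

section Online

/-- The rate `(t + t₀) ^ (-(2r-1)/(4r+2))`. -/
noncomputable def rateSeq (t₀ r : ℝ) (t : ℕ) : ℝ := (1 / (t + t₀)) ^ ((2 * r - 1) / (4 * r + 2))

/-- Here `n = ‖F‖` is controlled only through `l n² ≤ M² / 4`, a bound that degenerates as `l` tends
to `0`. The factor `s = x ^ (-1/2)` from the step size compensates, because `κ² ≤ x l`. -/
lemma noise_size_le {κ M l n s x : ℝ} (hκ : 0 ≤ κ) (hM : 0 ≤ M) (hl0 : 0 ≤ l) (hl1 : l ≤ 1)
    (hn : 0 ≤ n) (hs1 : s ≤ 1) (hx : 0 < x) (hs : s ^ 2 = 1 / x)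
    (hκl : κ ^ 2 ≤ x * l) (hln : l * n ^ 2 ≤ M ^ 2 / 4) :
    s * (κ * (M + κ * n) + l * n) ≤ M * (3 / 2 * κ + 1 / 2) := by
  have h1 : s * (κ * n) ≤ M / 2 := by
    refine le_of_sq_le_sq ?_ (by positivity)
    have h2 : s ^ 2 * κ ^ 2 ≤ l := by
      rw [hs, one_div_mul_eq_div, div_le_iff₀ hx]; linarith
    nlinarith [mul_le_mul_of_nonneg_right h2 (sq_nonneg n)]
  have h3 : l * n ≤ M / 2 := by
    refine le_of_sq_le_sq ?_ (by positivity)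
    nlinarith [mul_le_mul_of_nonneg_right hl1 (mul_nonneg hl0 (sq_nonneg n))]
  have h4 : s * (l * n) ≤ M / 2 := (mul_le_of_le_one_left (by positivity) hs1).trans h3
  have h5 : s * (κ * M) ≤ κ * M := mul_le_of_le_one_left (by positivity) hs1
  nlinarith [mul_le_mul_of_nonneg_left h1 hκ]

variable {H : Type*} [NormedAddCommGroup H] [InnerProductSpace ℝ H]

/-- The stochastic part of the online algorithm: the noise accumulated around the
regularization path `F`. -/
noncomputable def noiseSeq (γ lam : ℕ → ℝ) (F : ℕ → H) (v : ℕ → H) (y : ℕ → ℝ) : ℕ → H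
  | 0 => 0
  | t + 1 => onlineStep (γ (t + 1)) (lam (t + 1)) (v t) (noiseSeq γ lam F v y t)
      + γ (t + 1) • ((y t - inner ℝ (v t) (F (t + 1))) • v t - lam (t + 1) • F (t + 1))

/-- The distance of the online algorithm to the regularization path, up to noise. -/
lemma norm_sub_path_sub_noiseSeq_le {r a t₀ κ G : ℝ} (hr : r ∈ Set.Ioc (1 / 2 : ℝ) (3 / 2))
    (ha : 1 ≤ a) (ht₀ : 1 ≤ t₀) (hκ₀ : a * κ ^ 2 + 1 ≤ t₀ ^ (2 * r / (2 * r + 1)))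
    {v : ℕ → H} {y : ℕ → ℝ} (hv : ∀ t, ‖v t‖ ≤ κ) {F f : ℕ → H} (hG : 0 ≤ G)
    (hF : ∀ t, ‖F t - F (t + 1)‖ ≤ (regSeq a t₀ r t - regSeq a t₀ r (t + 1)) *
      regSeq a t₀ r t ^ (r - 3 / 2) * G)
    (hf0 : f 0 = 0)
    (hf : ∀ t, f (t + 1) = f t - stepSeq a t₀ r (t + 1) •
      ((inner ℝ (v t) (f t) - y t) • v t + regSeq a t₀ r (t + 1) • f t)) (t : ℕ) :
    ‖f t - F t - noiseSeq (stepSeq a t₀ r) (regSeq a t₀ r) F v y t‖ ≤ t₀ * ‖F 0‖ / (t + t₀)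
      + (4 * r + 2) / (2 * r + 3) * (a ^ (1 / 2 - r) * G) * rateSeq t₀ r t := by
  obtain ⟨hr0, hr1⟩ := hr
  set W := noiseSeq (stepSeq a t₀ r) (regSeq a t₀ r) F v y with hW
  induction t with
  | zero =>
    have h1 : t₀ * ‖F 0‖ / ((0 : ℕ) + t₀) = ‖F 0‖ := by
      rw [Nat.cast_zero, zero_add, mul_div_cancel_left₀ _ (by linarith)]
    have h2 : W 0 = 0 := rfl
    rw [h1, hf0, h2, zero_sub, sub_zero, norm_neg]
    have : 0 ≤ (4 * r + 2) / (2 * r + 3) * (a ^ (1 / 2 - r) * G) * rateSeq t₀ r 0 := by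
      rw [rateSeq]; positivity
    linarith
  | succ t ih =>
    set x : ℝ := t + t₀ with hx
    have hx1 : 1 ≤ x := by rw [hx]; linarith [(Nat.cast_nonneg t : (0 : ℝ) ≤ t)]
    have hx0 : 0 < x := by linarith
    have hxs : ((t + 1 : ℕ) : ℝ) + t₀ = x + 1 := by rw [hx]; push_cast; ring
    set γ := stepSeq a t₀ r (t + 1) with hγ
    set l := regSeq a t₀ r (t + 1) with hl
    have hγl : γ * l = 1 / (x + 1) := by
      rw [hγ, hl, stepSeq, regSeq, hxs, step_mul_reg hr0 ha (by linarith)]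
    have hγ0 : 0 ≤ γ := by rw [hγ, stepSeq, hxs]; positivity
    have hγκ : γ * ‖v t‖ ^ 2 ≤ 1 - γ * l := by
      have h1 : γ * κ ^ 2 ≤ 1 - 1 / (x + 1) := by
        rw [hγ, stepSeq, hxs]
        refine step_mul_le hr0 (by linarith) (hκ₀.trans ?_)
        refine Real.rpow_le_rpow (by linarith) ?_ (by positivity)
        rw [hx]; linarith [(Nat.cast_nonneg t : (0 : ℝ) ≤ t)]
      rw [hγl]
      refine le_trans ?_ h1
      gcongr
      exact hv t
    -- Subtracting `W` removes the noise, so the remaining error obeys a recursion driven only by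
    -- the displacement of the path.
    have hrec : f (t + 1) - F (t + 1) - W (t + 1)
        = onlineStep γ l (v t) ((f t - F t - W t) + (F t - F (t + 1))) := by
      have h1 : W (t + 1) = onlineStep γ l (v t) (W t)
        + γ • ((y t - inner ℝ (v t) (F (t + 1))) • v t - l • F (t + 1)) := rfl
      rw [h1, hf]
      simp only [onlineStep_apply, inner_add_right, inner_sub_right]
      module
    have hΔ : ‖F t - F (t + 1)‖ ≤ a ^ (1 / 2 - r) * G * rateSeq t₀ r t / (x + 1) := by
      have hd : 0 < regSeq a t₀ r t := by rw [regSeq]; positivity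
      have h1 : regSeq a t₀ r t - l ≤ regSeq a t₀ r t / (x + 1) := by
        rw [hl, regSeq, regSeq, hxs, ← mul_sub, mul_div_assoc]
        gcongr
        refine one_div_rpow_sub_le ?_ hx0
        rw [div_le_one (by linarith)]; linarith
      have h2 : regSeq a t₀ r t * regSeq a t₀ r t ^ (r - 3 / 2)
          = a ^ (1 / 2 - r) * rateSeq t₀ r t := by
        rw [rateSeq, ← reg_rpow hr0 ha hx0, ← Real.rpow_one_add' hd.le (by linarith)]
        rw [regSeq]
        congr 1; ring
      refine (hF t).trans ?_
      calc (regSeq a t₀ r t - l) * regSeq a t₀ r t ^ (r - 3 / 2) * G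
          ≤ regSeq a t₀ r t / (x + 1) * regSeq a t₀ r t ^ (r - 3 / 2) * G := by gcongr
        _ = regSeq a t₀ r t * regSeq a t₀ r t ^ (r - 3 / 2) * G / (x + 1) := by ring
        _ = _ := by rw [h2]; ring
    -- With `s` the exponent of the rate, `C` is exactly `1 / (1 - s)`.
    have hdrift := drift_step (s := (2 * r - 1) / (4 * r + 2)) (C := (4 * r + 2) / (2 * r + 3))
      (by rw [div_nonneg_iff]; left; constructor <;> linarith)
      (by rw [div_lt_one (by linarith)]; linarith)
      (by
        have : (4 * r + 2) / (2 * r + 3) * (1 - (2 * r - 1) / (4 * r + 2)) = 1 := by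
          field_simp; ring
        rw [this]) hx0
    have hrate : rateSeq t₀ r (t + 1) = (1 / (x + 1)) ^ ((2 * r - 1) / (4 * r + 2)) := by
      rw [rateSeq, hxs]
    have hrate' : rateSeq t₀ r t = (1 / x) ^ ((2 * r - 1) / (4 * r + 2)) := rfl
    rw [← hrate, ← hrate'] at hdrift
    set C := (4 * r + 2) / (2 * r + 3)
    set c := a ^ (1 / 2 - r) * G
    have hc : 0 ≤ c := by positivity
    have hB := norm_onlineStep_le hγ0 hγκ
    have hβ : 1 - γ * l = x / (x + 1) := by rw [hγl]; field_simp; ring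
    rw [hβ] at hB
    rw [hrec, hxs]
    refine ((onlineStep γ l (v t)).le_of_opNorm_le_of_le hB
      ((norm_add_le _ _).trans (add_le_add ih hΔ))).trans ?_
    have h1 : x / (x + 1) * (t₀ * ‖F 0‖ / x + C * c * rateSeq t₀ r t
          + c * rateSeq t₀ r t / (x + 1))
        = t₀ * ‖F 0‖ / (x + 1) + c * (x * rateSeq t₀ r t * (C + 1 / (x + 1))) / (x + 1) := by
      field_simp
      ring
    have h2 : C * c * rateSeq t₀ r (t + 1)
        = c * (C * ((x + 1) * rateSeq t₀ r (t + 1))) / (x + 1) := by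
      field_simp
    rw [h1, h2]
    gcongr

variable [CompleteSpace H] [MeasurableSpace H] [BorelSpace H] [SecondCountableTopology H]
  {Z : Type*} [MeasurableSpace Z] {ρ : Measure Z} [IsProbabilityMeasure ρ]
  {Ω : Type*} [MeasurableSpace Ω] {P : Measure Ω} [IsProbabilityMeasure P]

/-- The tail of the noise accumulated by the online algorithm. -/
lemma measure_lt_norm_noiseSeq_le {r a t₀ κ M : ℝ} (hr : r ∈ Set.Ioc (1 / 2 : ℝ) (3 / 2))
    (ha : 1 ≤ a) (ht₀ : 1 ≤ t₀) (hκ₀ : a * κ ^ 2 + 1 ≤ t₀ ^ (2 * r / (2 * r + 1)))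
    {k : Z → H} (hk : Measurable k) (hκ : ∀ u, ‖k u‖ ≤ κ) {y : Z → ℝ} (hy : Measurable y)
    (hM : ∀ᵐ u ∂ρ, |y u| ≤ M) {F : ℕ → H}
    (hF : ∀ t w, ∫ u, (y u - inner ℝ (k u) (F t)) * inner ℝ (k u) w ∂ρ
      = regSeq a t₀ r t * inner ℝ (F t) w)
    {z : ℕ → Ω → Z} (hz_meas : ∀ i, Measurable (z i)) (hz_indep : iIndepFun z P)
    (hz_law : ∀ i, P.map (z i) = ρ) (t : ℕ) {δ : ℝ} (hδ : δ ∈ Set.Ioo (0 : ℝ) 1) :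
    P {ω | a * M * (5 / 2 * κ + 1 / 2) * rateSeq t₀ r t * (1 + Real.log (2 / δ)) <
      ‖noiseSeq (stepSeq a t₀ r) (regSeq a t₀ r) F (fun i => k (z i ω)) (fun i => y (z i ω)) t‖}
      ≤ ENNReal.ofReal δ := by
  obtain ⟨hr0, hr1⟩ := hr
  have hκ0 : 0 ≤ κ := by
    obtain ⟨u₀⟩ : Nonempty Z := nonempty_of_isProbabilityMeasure ρ
    exact (norm_nonneg _).trans (hκ u₀)
  have hM0 : 0 ≤ M := by
    obtain ⟨u, hu⟩ := hM.exists
    exact (abs_nonneg _).trans hu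
  set W : ℕ → Ω → H := fun t ω => noiseSeq (stepSeq a t₀ r) (regSeq a t₀ r) F
    (fun i => k (z i ω)) (fun i => y (z i ω)) t with hW
  set γ := stepSeq a t₀ r with hγ
  set l := regSeq a t₀ r with hl
  set φ := rateSeq t₀ r with hφ
  set B : ℕ → Z → H →L[ℝ] H := fun t u => onlineStep (γ (t + 1)) (l (t + 1)) (k u) with hB
  set ξ : ℕ → Z → H := fun t u =>
    (y u - inner ℝ (k u) (F (t + 1))) • k u - l (t + 1) • F (t + 1) with hξ
  have hx1 : ∀ t : ℕ, 1 ≤ t + t₀ := fun t => by linarith [(Nat.cast_nonneg t : (0 : ℝ) ≤ t)]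
  have hx0 : ∀ t : ℕ, 0 < t + t₀ := fun t => by linarith [hx1 t]
  have hxs : ∀ t : ℕ, ((t + 1 : ℕ) : ℝ) + t₀ = t + t₀ + 1 := fun t => by push_cast; ring
  have hl0 : ∀ t, 0 ≤ l t := fun t => by rw [hl, regSeq]; have := hx0 t; positivity
  have hl1 : ∀ t, l t ≤ 1 := fun t => reg_le_one hr0 ha (hx1 t)
  have hγ0 : ∀ t, 0 ≤ γ t := fun t => by rw [hγ, stepSeq]; have := hx0 t; positivity
  have hφ0 : ∀ t, 0 ≤ φ t := fun t => by rw [hφ, rateSeq]; have := hx0 t; positivity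
  have hγφ : ∀ t, γ t = a * (φ t * √(1 / (t + t₀))) := fun t => by
    rw [hγ, stepSeq, one_div_rpow_two_mul_div hr0 (hx0 t)]; rfl
  have hpow : ∀ t : ℕ, a * κ ^ 2 + 1 ≤ (t + t₀) ^ (2 * r / (2 * r + 1)) := fun t => by
    refine hκ₀.trans (Real.rpow_le_rpow (by linarith) ?_ (by positivity))
    linarith [(Nat.cast_nonneg t : (0 : ℝ) ≤ t)]
  have hnoise := fun t => tikhonov_noise_bounds hk.stronglyMeasurable hκ hy hM (hl0 t) (hF t)
  have hγl : ∀ t, γ t * l t = 1 / (t + t₀) := fun t => step_mul_reg hr0 ha (hx0 t)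
  have hBβ : ∀ t u, ‖B t u‖ ≤ (t + t₀) / (t + t₀ + 1) := fun t u => by
    have h1 : γ (t + 1) * κ ^ 2 ≤ 1 - 1 / ((t + 1 : ℕ) + t₀) :=
      step_mul_le hr0 (hx1 _) (hpow _)
    have h2 := norm_onlineStep_le (l := l (t + 1)) (hγ0 (t + 1)) (v := k u) (by
      rw [hγl]
      refine le_trans ?_ h1
      have := hγ0 (t + 1)
      gcongr
      exact hκ u)
    rw [hγl, hxs] at h2
    refine h2.trans_eq ?_
    have := hx0 t
    field_simp
    ring
  have hs1 : (2 * r - 1) / (4 * r + 2) < 1 / 2 := by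
    rw [div_lt_div_iff₀ (by linarith) (by norm_num)]; linarith
  have hφs : ∀ t : ℕ, φ (t + 1) = (1 / (t + t₀ + 1)) ^ ((2 * r - 1) / (4 * r + 2)) := fun t => by
    rw [hφ, rateSeq, hxs]
  have hsize : ∀ t, ∀ᵐ u ∂ρ, ‖γ (t + 1) • ξ t u‖
      ≤ a * M * (3 / 2 * κ + 1 / 2) * φ (t + 1) := fun t => by
    filter_upwards [(hnoise (t + 1)).2.1] with u hu
    rw [norm_smul, Real.norm_of_nonneg (hγ0 _)]
    have hx := hx0 (t + 1)
    have h1 := noise_size_le hκ0 hM0 (hl0 (t + 1)) (hl1 (t + 1)) (norm_nonneg (F (t + 1)))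
      (Real.sqrt_le_one.2 ((div_le_one hx).2 (hx1 (t + 1)))) hx
      (Real.sq_sqrt (by positivity)) (sq_le_mul_reg hr0 ha hx (hpow (t + 1)))
      (hnoise (t + 1)).1
    have haφ : 0 ≤ a * φ (t + 1) := mul_nonneg (by linarith) (hφ0 _)
    calc γ (t + 1) * ‖ξ t u‖
        ≤ γ (t + 1) * (κ * (M + κ * ‖F (t + 1)‖) + l (t + 1) * ‖F (t + 1)‖) :=
          mul_le_mul_of_nonneg_left hu (hγ0 _)
      _ = a * φ (t + 1) * (√(1 / ((t + 1 : ℕ) + t₀)) *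
            (κ * (M + κ * ‖F (t + 1)‖) + l (t + 1) * ‖F (t + 1)‖)) := by
          rw [hγφ]; ring
      _ ≤ a * φ (t + 1) * (M * (3 / 2 * κ + 1 / 2)) := mul_le_mul_of_nonneg_left h1 haφ
      _ = _ := by ring
  have hBm : ∀ t, Measurable fun q : H × Z => B t q.2 q.1 := fun t => by
    have hkm : Measurable fun q : H × Z => k q.2 := hk.comp measurable_snd
    simp only [hB, onlineStep_apply]
    exact measurable_fst.sub ((((hkm.inner measurable_fst).smul hkm).add
      (measurable_fst.const_smul _)).const_smul _)
  have hξm : ∀ t, Measurable fun u => γ (t + 1) • ξ t u := fun t =>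
    (((hy.sub (hk.inner measurable_const)).smul hk).sub measurable_const).const_smul _
  have hvstep : ∀ t : ℕ, ((t + t₀) / (t + t₀ + 1)) ^ 2 * (a ^ 2 * κ ^ 2 * M ^ 2 * φ t ^ 2)
      + ∫ u, ‖γ (t + 1) • ξ t u‖ ^ 2 ∂ρ ≤ a ^ 2 * κ ^ 2 * M ^ 2 * φ (t + 1) ^ 2 := fun t => by
    have h1 : ∫ u, ‖γ (t + 1) • ξ t u‖ ^ 2 ∂ρ ≤ γ (t + 1) ^ 2 * (κ ^ 2 * M ^ 2) := by
      simp_rw [norm_smul, mul_pow, integral_const_mul]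
      rw [Real.norm_eq_abs, sq_abs]
      exact mul_le_mul_of_nonneg_left (hnoise (t + 1)).2.2.2 (sq_nonneg _)
    have hx := hx0 (t + 1)
    have h2 : γ (t + 1) ^ 2 = a ^ 2 * (φ (t + 1) ^ 2 / (t + t₀ + 1)) := by
      rw [hγφ, mul_pow, mul_pow, Real.sq_sqrt (by positivity), hxs]; ring
    have h3 := sq_one_div_rpow_step hs1 (hx0 t)
    rw [← hφs] at h3
    have h4 := mul_le_mul_of_nonneg_left h3 (show 0 ≤ a ^ 2 * κ ^ 2 * M ^ 2 by positivity)
    rw [h2] at h1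
    have h5 : φ t = (1 / (t + t₀)) ^ ((2 * r - 1) / (4 * r + 2)) := rfl
    rw [← h5] at h4
    linarith
  have hmstep : ∀ t : ℕ, (t + t₀) / (t + t₀ + 1) * (a * M * (3 / 2 * κ + 1 / 2) * φ t)
      ≤ a * M * (3 / 2 * κ + 1 / 2) * φ (t + 1) := fun t => by
    have h1 := mul_one_div_rpow_mono (s := (2 * r - 1) / (4 * r + 2)) (by linarith) (hx0 t)
    rw [← hφs] at h1
    have h5 : φ t = (1 / (t + t₀)) ^ ((2 * r - 1) / (4 * r + 2)) := rfl
    rw [← h5] at h1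
    have hx := hx0 t
    have h2 : (t + t₀) / (t + t₀ + 1) * φ t ≤ φ (t + 1) := by
      rw [div_mul_eq_mul_div, div_le_iff₀ (by linarith)]; linarith
    have h3 := mul_le_mul_of_nonneg_left h2
      (show 0 ≤ a * M * (3 / 2 * κ + 1 / 2) by positivity)
    linarith
  have hWrec : ∀ t ω, W (t + 1) ω = B t (z t ω) (W t ω) + γ (t + 1) • ξ t (z t ω) :=
    fun t ω => rfl
  have hWm := (indepFun_of_recursion hz_meas hz_indep
    (G := fun t q => B t q.2 q.1 + γ (t + 1) • ξ t q.2)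
    (fun t => (hBm t).add ((hξm t).comp measurable_snd)) (w₀ := 0) (W := W) (fun ω => rfl)
    hWrec t).1
  have hexp := lintegral_cosh_norm_recursion_le hz_meas hz_indep hz_law hBm hξm
    (m := fun t => a * M * (3 / 2 * κ + 1 / 2) * φ t)
    (v := fun t => a ^ 2 * κ ^ 2 * M ^ 2 * φ t ^ 2) hBβ (by positivity) hmstep hsize
    (fun t => by rw [integral_smul, (hnoise (t + 1)).2.2.1, smul_zero]) hvstep
    (W := W) (fun ω => rfl) hWrec t
  have hφt := hφ0 t
  -- The scale has to dominate the size bound `m` and the deviation `√v = a κ M φ`; the factor `5 /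
  -- 2` does so with room to spare.
  refine measure_lt_norm_recursion_le hWm (by positivity) ?_ ?_ hexp hδ
  · gcongr
    norm_num
  · have h1 : a ^ 2 * κ ^ 2 * M ^ 2 * φ t ^ 2 = (a * M * κ * φ t) ^ 2 := by ring
    rw [h1]
    gcongr
    linarith

end Online

/-! ### Constants, almost sure convergence and the final assembly -/

/-- If `κ = 0`, then `K = 0` and the constant `1` is an eigenfunction for the eigenvalue `0`.
Positivity matters because the noise constant divides by `κ`. -/
lemma kappa_pos_of_eigenvaluesPos {X : Type*} [TopologicalSpace X] [MeasurableSpace X]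
    {K : MercerKernel X} (hκ : BddAbove (Set.range fun x : X => √(K x x))) {ν : Measure X}
    [IsProbabilityMeasure ν] (hpos : K.EigenvaluesPos ν) : 0 < K.kappa := by
  by_contra hk
  have hK : ∀ x s, K x s = 0 := fun x s => by
    have h0 : K.kerAt x = 0 :=
      norm_le_zero_iff.1 ((K.norm_kerAt_le_kappa hκ x).trans (not_lt.1 hk))
    rw [← MercerKernel.inner_kerAt_kerAt, h0, inner_zero_left]
  refine lt_irrefl (0 : ℝ) (hpos 0 (fun _ => 1) ⟨memLp_const 1, Eventually.of_forall fun x => ?_⟩ ?_)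
  · simp [MercerKernel.integralOp, hK]
  · intro h
    obtain ⟨x, hx⟩ := h.exists
    exact one_ne_zero hx

lemma ae_abs_snd_le_of_support_subset {X : Type*} [TopologicalSpace X] [SecondCountableTopology X]
    [MeasurableSpace X] {ρ : Measure (X × ℝ)} {M : ℝ}
    (hρ : ρ.support ⊆ Set.univ ×ˢ Set.Icc (-M) M) : ∀ᵐ u ∂ρ, |u.2| ≤ M := by
  filter_upwards [Measure.support_mem_ae (μ := ρ)] with u hu
  exact abs_le.2 (hρ hu).2

lemma integral_regressionFun_mul {X : Type*} [MeasurableSpace X] {ρ : Measure (X × ℝ)}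
    [IsFiniteMeasure ρ] {M C : ℝ} (hM : ∀ᵐ u ∂ρ, |u.2| ≤ M) {w : X → ℝ} (hw : Measurable w)
    (hC : ∀ x, |w x| ≤ C) :
    ∫ x, regressionFun ρ x * w x ∂ρ.fst = ∫ u, u.2 * w u.1 ∂ρ := by
  have hint : Integrable (fun u : X × ℝ => u.2 * w u.1) ρ := by
    refine Integrable.of_bound
      (measurable_snd.mul (hw.comp measurable_fst)).aestronglyMeasurable (M * C) ?_
    filter_upwards [hM] with u hu
    rw [norm_mul]
    exact mul_le_mul hu (hC _) (norm_nonneg _) ((abs_nonneg _).trans hu)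
  rw [← Measure.integral_condKernel hint]
  refine integral_congr_ae (Eventually.of_forall fun x => ?_)
  simp only [regressionFun]
  rw [integral_mul_const]

/-- The weak normal equation of the regularization path, over the joint distribution. -/
lemma integral_residual_mul {X : Type*} [TopologicalSpace X] [SecondCountableTopology X]
    [MeasurableSpace X] [BorelSpace X] {K : MercerKernel X}
    (hκ : BddAbove (Set.range fun x : X => √(K x x))) {ρ : Measure (X × ℝ)}
    [IsProbabilityMeasure ρ] {M : ℝ} (hM : ∀ᵐ u ∂ρ, |u.2| ≤ M) {F w : K.HK} {l : ℝ}
    (h : ∫ x, F x * w x ∂ρ.fst + l * inner ℝ F w = ∫ x, regressionFun ρ x * w x ∂ρ.fst) :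
    ∫ u, (u.2 - inner ℝ (K.kerAt u.1) F) * inner ℝ (K.kerAt u.1) w ∂ρ = l * inner ℝ F w := by
  have hm : ∀ w : K.HK, Measurable fun x => w x := fun w => by
    have : Continuous fun x => inner ℝ (K.kerAt x) w := K.continuous_kerAt.inner continuous_const
    simpa only [MercerKernel.inner_kerAt_left] using this.measurable
  have hb : ∀ (w : K.HK) x, |w x| ≤ K.kappa * ‖w‖ := fun w x => by
    rw [← MercerKernel.inner_kerAt_left]
    exact (abs_real_inner_le_norm _ _).trans
      (mul_le_mul_of_nonneg_right (K.norm_kerAt_le_kappa hκ x) (norm_nonneg w))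
  have hfst : ∫ x, F x * w x ∂ρ.fst = ∫ u, F u.1 * w u.1 ∂ρ :=
    integral_map measurable_fst.aemeasurable
      ((hm F).mul (hm w)).aestronglyMeasurable
  rw [integral_regressionFun_mul hM (hm w) (hb w), hfst] at h
  simp only [MercerKernel.inner_kerAt_left, sub_mul]
  rw [integral_sub]
  · linarith
  · refine Integrable.of_bound
      (measurable_snd.mul ((hm w).comp measurable_fst)).aestronglyMeasurable
      (M * (K.kappa * ‖w‖)) ?_
    filter_upwards [hM] with u hu
    rw [norm_mul]
    exact mul_le_mul hu (hb w _) (norm_nonneg _) ((abs_nonneg _).trans hu)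
  · refine Integrable.of_bound
      (((hm F).comp measurable_fst).mul ((hm w).comp measurable_fst)).aestronglyMeasurable
      (K.kappa * ‖F‖ * (K.kappa * ‖w‖)) (Eventually.of_forall fun u => ?_)
    rw [norm_mul]
    exact mul_le_mul (hb F _) (hb w _) (norm_nonneg _) ((abs_nonneg _).trans (hb F u.1))

lemma regSeq_pos {a t₀ r : ℝ} (ha : 1 ≤ a) (ht₀ : 0 < t₀) (t : ℕ) : 0 < regSeq a t₀ r t := by
  rw [regSeq]; positivity

lemma regSeq_succ_le {a t₀ r : ℝ} (ha : 1 ≤ a) (ht₀ : 0 < t₀) (hr : 1 / 2 < r) (t : ℕ) :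
    regSeq a t₀ r (t + 1) ≤ regSeq a t₀ r t := by
  rw [regSeq, regSeq]
  push_cast
  gcongr
  linarith

/-- The initial error of the online algorithm. -/
lemma mul_norm_path_zero_le {a t₀ r M n : ℝ} (ha : 1 ≤ a) (ht₀ : 0 < t₀) (hr : 1 / 2 < r)
    (hM : 0 ≤ M) (h : regSeq a t₀ r 0 * n ^ 2 ≤ M ^ 2 / 4) :
    t₀ * n ≤ 2 * √a * t₀ ^ ((4 * r + 3) / (4 * r + 2)) * M := by
  have ha0 : 0 < a := by linarith
  have h1 : t₀ ^ ((4 * r + 3) / (4 * r + 2)) = t₀ * √(t₀ ^ (1 / (2 * r + 1))) := by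
    rw [Real.sqrt_eq_rpow, ← Real.rpow_mul ht₀.le, ← Real.rpow_one_add' ht₀.le (by positivity)]
    congr 1
    field_simp
    ring
  have h2 : n ≤ √a * √(t₀ ^ (1 / (2 * r + 1))) * (M / 2) := by
    refine le_of_sq_le_sq ?_ (by positivity)
    rw [mul_pow, mul_pow, Real.sq_sqrt ha0.le, Real.sq_sqrt (by positivity)]
    rw [regSeq, Nat.cast_zero, zero_add, one_div t₀, Real.inv_rpow ht₀.le] at h
    have h3 : 0 < t₀ ^ (1 / (2 * r + 1)) := by positivity
    field_simp at h ⊢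
    linarith
  rw [h1]
  have h4 : 0 ≤ √a * √(t₀ ^ (1 / (2 * r + 1))) * M := by positivity
  nlinarith [mul_le_mul_of_nonneg_left h2 ht₀.le, mul_nonneg ht₀.le h4]

/-- The left side adds the drift constant to the constant `1` of the approximation error. The claim
reduces to `12 r² - 16 r - 3 ≤ 0`, with equality at `r = 3 / 2`. -/
lemma bias_constant_le {r : ℝ} (hr : r ∈ Set.Ioc (1 / 2 : ℝ) (3 / 2)) :
    (4 * r + 2) / (2 * r + 3) + 1 ≤ (20 * r - 2) / ((2 * r - 1) * (2 * r + 3)) := by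
  obtain ⟨h0, h1⟩ := hr
  have h2 : 0 < 2 * r - 1 := by linarith
  have h3 : 0 < 2 * r + 3 := by linarith
  rw [div_add_one h3.ne', div_le_div_iff₀ h3 (by positivity)]
  have h4 : (6 * r + 5) * (2 * r - 1) ≤ 20 * r - 2 := by nlinarith
  nlinarith [mul_le_mul_of_nonneg_right h4 h3.le]

/-- `L` stands for `log (2 / δ) ≥ log 2 > 0.69`, which allows `1 + L` to be absorbed into `5 / 2 *
L`. -/
lemma noise_constant_le {a M κ φ L : ℝ} (ha : 0 ≤ a) (hM : 0 ≤ M) (hκ : 0 < κ) (hφ : 0 ≤ φ)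
    (hL : 0.69 ≤ L) :
    a * M * (5 / 2 * κ + 1 / 2) * φ * (1 + L) ≤ 20 * (κ + 1) ^ 2 * M / κ * a * L * φ := by
  have h1 : (5 / 2 * κ + 1 / 2) * (1 + L) ≤ 20 * (κ + 1) ^ 2 / κ * L := by
    have h2 : (5 / 2 * κ + 1 / 2) * (5 / 2) ≤ 20 * (κ + 1) ^ 2 / κ := by
      rw [le_div_iff₀ hκ]; nlinarith
    have h3 : (1 + L) ≤ 5 / 2 * L := by norm_num at hL; linarith
    calc (5 / 2 * κ + 1 / 2) * (1 + L) ≤ (5 / 2 * κ + 1 / 2) * (5 / 2 * L) := by gcongr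
      _ = (5 / 2 * κ + 1 / 2) * (5 / 2) * L := by ring
      _ ≤ _ := by gcongr
  calc a * M * (5 / 2 * κ + 1 / 2) * φ * (1 + L)
      = a * M * φ * ((5 / 2 * κ + 1 / 2) * (1 + L)) := by ring
    _ ≤ a * M * φ * (20 * (κ + 1) ^ 2 / κ * L) := by gcongr
    _ = _ := by ring

lemma tendsto_rateSeq_mul_log {r t₀ c d : ℝ} (hr : 1 / 2 < r) :
    Tendsto (fun t : ℕ => rateSeq t₀ r t * (c + d * Real.log (t + t₀))) atTop (𝓝 0) := by
  have hs : 0 < (2 * r - 1) / (4 * r + 2) := div_pos (by linarith) (by linarith)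
  have hx : Tendsto (fun t : ℕ => (t : ℝ) + t₀) atTop atTop :=
    tendsto_atTop_add_const_right _ _ tendsto_natCast_atTop_atTop
  have h1 := (isLittleO_log_rpow_atTop hs).tendsto_div_nhds_zero.comp hx
  have h2 := (tendsto_rpow_neg_atTop hs).comp hx
  have h3 := (h2.mul_const c).add (h1.const_mul d)
  simp only [zero_mul, mul_zero, add_zero] at h3
  refine h3.congr' ?_
  filter_upwards [hx.eventually_gt_atTop 0] with t ht
  simp only [Function.comp_apply, rateSeq]
  rw [one_div, Real.inv_rpow ht.le, Real.rpow_neg ht.le]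
  field_simp

lemma tendsto_norm_zero_of_tail {Ω H : Type*} [MeasurableSpace Ω] {P : Measure Ω}
    [NormedAddCommGroup H] {W : ℕ → Ω → H} {r t₀ D : ℝ} (hr : 1 / 2 < r) (ht₀ : 1 ≤ t₀)
    (hW : ∀ t, ∀ δ ∈ Set.Ioo (0 : ℝ) 1,
      P {ω | D * rateSeq t₀ r t * (1 + Real.log (2 / δ)) < ‖W t ω‖} ≤ ENNReal.ofReal δ) :
    ∀ᵐ ω ∂P, Tendsto (fun t => ‖W t ω‖) atTop (𝓝 0) := by
  have hx1 : ∀ t : ℕ, 1 ≤ t + t₀ := fun t => by linarith [(Nat.cast_nonneg t : (0 : ℝ) ≤ t)]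
  -- These levels are summable, as Borel–Cantelli needs, while `log (2 / δ t)` grows only like `2
  -- log (t + t₀)`, which the polynomial rate beats.
  set δ : ℕ → ℝ := fun t => 1 / 2 * (1 / |(t : ℝ) + t₀| ^ (2 : ℝ)) with hδ
  have hδeq : ∀ t : ℕ, δ t = 1 / (2 * (t + t₀) ^ 2) := fun t => by
    simp only [hδ]
    rw [abs_of_pos (by linarith [hx1 t]), Real.rpow_two]
    field_simp
  have hδ01 : ∀ t, δ t ∈ Set.Ioo (0 : ℝ) 1 := fun t => by
    have h1 := hx1 t
    rw [hδeq]
    refine ⟨by positivity, ?_⟩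
    rw [div_lt_one (by positivity)]
    nlinarith
  have hsum : Summable δ :=
    ((Real.summable_one_div_nat_add_rpow t₀ 2).2 (by norm_num)).mul_left _
  have hfin : ∑' t, P {ω | D * rateSeq t₀ r t * (1 + Real.log (2 / δ t)) < ‖W t ω‖} ≠ ⊤ :=
    ne_top_of_le_ne_top hsum.tsum_ofReal_ne_top
      (ENNReal.tsum_le_tsum fun t => hW t (δ t) (hδ01 t))
  filter_upwards [ae_eventually_notMem hfin] with ω hω
  have hlim := (tendsto_rateSeq_mul_log (t₀ := t₀) (c := 1 + Real.log 4) (d := 2) hr).const_mul D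
  rw [mul_zero] at hlim
  refine squeeze_zero' (Eventually.of_forall fun t => norm_nonneg _) ?_ hlim
  filter_upwards [hω] with t ht
  have h1 := not_lt.1 ht
  have h2 : Real.log (2 / δ t) = Real.log 4 + 2 * Real.log (t + t₀) := by
    have hx := hx1 t
    have hx0 : (t : ℝ) + t₀ ≠ 0 := by linarith
    have h3 : 2 / δ t = 4 * (t + t₀) ^ 2 := by
      rw [hδeq]; field_simp; norm_num
    rw [h3, Real.log_mul (by norm_num) (by positivity), Real.log_pow]
    norm_num
  rw [h2] at h1
  linarith

theorem theoremB {n : ℕ} (X : Set (EuclideanSpace ℝ (Fin n))) (hX : IsClosed X)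
    (K : MercerKernel X) (hκ : BddAbove (Set.range fun x : X => √(K x x)))
    (ρ : Measure (X × ℝ)) [IsProbabilityMeasure ρ]
    (M : ℝ) (hM : 0 ≤ M) (hρ : ρ.support ⊆ Set.univ ×ˢ Set.Icc (-M) M)
    (hpos : K.EigenvaluesPos ρ.fst)
    (r : ℝ) (hr : r ∈ Set.Ioc (1 / 2 : ℝ) (3 / 2))
    -- `g = L_K^{-r} f_ρ`
    (g : X → ℝ) (hg : K.IsRpow ρ.fst r g (regressionFun ρ))
    (a t₀ : ℝ) (ha : 1 ≤ a) (ht₀ : 0 < t₀)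
    (hat₀ : a * K.kappa ^ 2 + 1 ≤ t₀ ^ (2 * r / (2 * r + 1)))
    {Ω : Type*} [MeasurableSpace Ω] (P : Measure Ω) [IsProbabilityMeasure P]
    (z : ℕ → Ω → X × ℝ) (hz_meas : ∀ i, Measurable (z i))
    (hz_indep : iIndepFun z P) (hz_law : ∀ i, P.map (z i) = ρ) :
    (∃! fρ : K.HK, K.IsVersion ρ.fst (regressionFun ρ) fρ) ∧
    ∀ fρ : K.HK, K.IsVersion ρ.fst (regressionFun ρ) fρ →
      (∀ t : ℕ, 1 ≤ t → ∀ δ ∈ Set.Ioo (0 : ℝ) 1,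
        ENNReal.ofReal (1 - δ) ≤
          P {ω | ‖K.onlineSeq (stepSeq a t₀ r) (regSeq a t₀ r) (fun i => z i ω) t - fρ‖ ≤
            2 * √a * t₀ ^ ((4 * r + 3) / (4 * r + 2)) * M / (t + t₀)
            + ((20 * r - 2) / ((2 * r - 1) * (2 * r + 3)) * l2norm ρ.fst g * a ^ (1 / 2 - r)
                + 20 * (K.kappa + 1) ^ 2 * M / K.kappa * a * Real.log (2 / δ))
              * (1 / (t + t₀)) ^ ((2 * r - 1) / (4 * r + 2))}) ∧
      ∀ᵐ ω ∂P, Tendsto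
        (fun t => K.onlineSeq (stepSeq a t₀ r) (regSeq a t₀ r) (fun i => z i ω) t)
        atTop (𝓝 fρ) := by
  have hM' := ae_abs_snd_le_of_support_subset hρ
  have hr0 := hr.1
  have ha0 : 0 < a := by linarith
  have hκ0 := kappa_pos_of_eigenvaluesPos hκ hpos
  have ht1 : 1 ≤ t₀ := by
    by_contra hlt
    have := Real.rpow_lt_one ht₀.le (not_le.1 hlt)
      (show 0 < 2 * r / (2 * r + 1) from div_pos (by linarith) (by linarith))
    nlinarith [mul_nonneg ha0.le (sq_nonneg K.kappa)]
  obtain ⟨h, hver, huniq, F, hF⟩ := MercerKernel.exists_version_and_path hκ hpos hr hg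
  refine ⟨⟨h, hver, huniq⟩, fun fρ hfρ => ?_⟩
  obtain rfl := huniq fρ hfρ
  let _ : MeasurableSpace K.HK := borel _
  have : BorelSpace K.HK := ⟨rfl⟩
  have : TopologicalSpace.SeparableSpace K.HK := K.separableSpace_HK
  have : SecondCountableTopology K.HK := UniformSpace.secondCountable_of_separable _
  set G := l2norm ρ.fst g with hG
  have hG0 : 0 ≤ G := Real.sqrt_nonneg _
  set Fs : ℕ → K.HK := fun t => F (regSeq a t₀ r t) with hFs
  have hweak : ∀ t w, ∫ u, (u.2 - inner ℝ (K.kerAt u.1) (Fs t)) * inner ℝ (K.kerAt u.1) w ∂ρ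
      = regSeq a t₀ r t * inner ℝ (Fs t) w := fun t w =>
    integral_residual_mul hκ hM' ((hF _ (regSeq_pos ha ht₀ t)).1 w)
  set k : X × ℝ → K.HK := fun u => K.kerAt u.1 with hk
  have hkm : Measurable k := K.continuous_kerAt.measurable.comp measurable_fst
  have hkκ : ∀ u, ‖k u‖ ≤ K.kappa := fun u => K.norm_kerAt_le_kappa hκ u.1
  set W : ℕ → Ω → K.HK := fun t ω => noiseSeq (stepSeq a t₀ r) (regSeq a t₀ r) Fs
    (fun i => k (z i ω)) (fun i => (z i ω).2) t with hW
  have htail : ∀ t, ∀ δ ∈ Set.Ioo (0 : ℝ) 1,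
      P {ω | a * M * (5 / 2 * K.kappa + 1 / 2) * rateSeq t₀ r t * (1 + Real.log (2 / δ))
        < ‖W t ω‖} ≤ ENNReal.ofReal δ := fun t δ hδ =>
    measure_lt_norm_noiseSeq_le hr ha ht1 hat₀ hkm hkκ measurable_snd hM' hweak hz_meas hz_indep
      hz_law t hδ
  have hinit : t₀ * ‖Fs 0‖ ≤ 2 * √a * t₀ ^ ((4 * r + 3) / (4 * r + 2)) * M :=
    mul_norm_path_zero_le ha ht₀ hr0 hM (tikhonov_noise_bounds hkm.stronglyMeasurable hkκ
      measurable_snd hM' (regSeq_pos ha ht₀ 0).le (hweak 0)).1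
  have hpath : ∀ t ω, ‖K.onlineSeq (stepSeq a t₀ r) (regSeq a t₀ r) (fun i => z i ω) t - fρ‖ ≤
      ‖W t ω‖ + 2 * √a * t₀ ^ ((4 * r + 3) / (4 * r + 2)) * M / (t + t₀)
      + (20 * r - 2) / ((2 * r - 1) * (2 * r + 3)) * G * a ^ (1 / 2 - r) * rateSeq t₀ r t := by
    intro t ω
    set f : ℕ → K.HK := K.onlineSeq (stepSeq a t₀ r) (regSeq a t₀ r) (fun i => z i ω) with hf
    have h1 := norm_sub_path_sub_noiseSeq_le hr ha ht1 hat₀ (fun i => hkκ (z i ω)) (F := Fs)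
      (f := f) (y := fun i => (z i ω).2) hG0 (fun t => by
        rw [norm_sub_rev]
        exact (hF _ (regSeq_pos ha ht₀ (t + 1))).2.2 _ (regSeq_succ_le ha ht₀ hr0 t)) rfl
      (fun t => by
        simp only [hk]
        rw [MercerKernel.inner_kerAt_left]
        rfl) t
    have h2 : ‖Fs t - fρ‖ ≤ a ^ (1 / 2 - r) * rateSeq t₀ r t * G := by
      refine (hF _ (regSeq_pos ha ht₀ t)).2.1.trans_eq ?_
      rw [regSeq, reg_rpow hr0 ha (by positivity)]
      rfl
    -- Noise, drift with initial error, and approximation error.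
    have h3 : f t - fρ = W t ω + (f t - Fs t - W t ω) + (Fs t - fρ) := by abel
    have h4 : 0 ≤ a ^ (1 / 2 - r) * rateSeq t₀ r t * G := (norm_nonneg _).trans h2
    have h5 := mul_le_mul_of_nonneg_right (bias_constant_le hr) h4
    have h6 : t₀ * ‖Fs 0‖ / (t + t₀)
        ≤ 2 * √a * t₀ ^ ((4 * r + 3) / (4 * r + 2)) * M / (t + t₀) := by gcongr
    have h7 := norm_add₃_le (a := W t ω) (b := f t - Fs t - W t ω) (c := Fs t - fρ)
    rw [← h3] at h7
    have h8 : ‖f t - Fs t - W t ω‖ ≤ t₀ * ‖Fs 0‖ / (t + t₀)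
      + (4 * r + 2) / (2 * r + 3) * (a ^ (1 / 2 - r) * G) * rateSeq t₀ r t := h1
    linarith
  refine ⟨fun t _ δ hδ => ?_, ?_⟩
  · have hφ : (1 / ((t : ℝ) + t₀)) ^ ((2 * r - 1) / (4 * r + 2)) = rateSeq t₀ r t := rfl
    rw [hφ]
    have hφ0 : 0 ≤ rateSeq t₀ r t := by rw [rateSeq]; positivity
    have hL : 0.69 ≤ Real.log (2 / δ) := by
      have h1 := Real.log_two_gt_d9
      have h2 : Real.log 2 ≤ Real.log (2 / δ) := by
        refine Real.log_le_log (by norm_num) ?_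
        rw [le_div_iff₀ hδ.1]
        linarith [hδ.2]
      norm_num at h1 ⊢
      linarith
    have hconst := noise_constant_le ha0.le hM hκ0 hφ0 hL
    rw [ENNReal.ofReal_sub _ hδ.1.le, ENNReal.ofReal_one, tsub_le_iff_right]
    refine le_trans ?_ (add_le_add_right (htail t δ hδ) _)
    -- Covering the whole space by the good and the bad event needs only subadditivity, hence no
    -- measurability of either.
    rw [← measure_univ (μ := P)]
    refine (measure_mono fun ω _ => ?_).trans (measure_union_le _ _)
    by_cases hω : a * M * (5 / 2 * K.kappa + 1 / 2) * rateSeq t₀ r t * (1 + Real.log (2 / δ))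
        < ‖W t ω‖
    · exact Or.inr hω
    · left
      have h1 := hpath t ω
      have h2 := not_lt.1 hω
      change ‖K.onlineSeq (stepSeq a t₀ r) (regSeq a t₀ r) (fun i => z i ω) t - fρ‖ ≤ _
      linarith
  · filter_upwards [tendsto_norm_zero_of_tail hr0 ht1 htail] with ω hω
    rw [tendsto_iff_norm_sub_tendsto_zero]
    refine squeeze_zero (fun t => norm_nonneg _) (fun t => hpath t ω) ?_
    have hx : Tendsto (fun t : ℕ => (t : ℝ) + t₀) atTop atTop :=
      tendsto_atTop_add_const_right _ _ tendsto_natCast_atTop_atTop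
    have h1 := tendsto_rateSeq_mul_log (t₀ := t₀) (c := 1) (d := 0) hr0
    simp only [zero_mul, add_zero, mul_one] at h1
    have h2 := (hω.add (hx.const_div_atTop
      (2 * √a * t₀ ^ ((4 * r + 3) / (4 * r + 2)) * M))).add (h1.const_mul
      ((20 * r - 2) / ((2 * r - 1) * (2 * r + 3)) * G * a ^ (1 / 2 - r)))
    simpa using h2
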